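/- Let $q:\mathbb{R}\to\mathbb{R}$ be integrable, non-negative almost everywhere, and not almost everywhere zero. Consider the eigenvalue problem on $L^2(\mathbb{R})$ $$-u''(x)+\left[x^2+q(x)\right]u(x)=\lambda u(x),\qquad x\in\mathbb{R},$$ that is, an eigenvalue is a real number $\lambda$ for which there is a non-zero $u\in L^2(\mathbb{R})$, with $u$ differentiable and $u'$ locally absolutely continuous, satisfying the equation almost everywhere. Then the eigenvalues, repeated according to multiplicity, form a non-decreasing sequence $\lambda_0\le\lambda_1\le\dots\to\infty$. Put $\lambda_k^0:=2k+1$, the eigenvalues of the unperturbed problem $q=0$, and $$\omega_n:=\begin{cases}\dfrac{2n+3}{n+1}\,\dfrac{\Gamma\left(\frac n2+1\right)}{\Gamma\left(\frac{n+1}{2}\right)}, & n\text{ odd},\\[3mm] (n+1)\,\dfrac{\Gamma\left(\frac{n+1}{2}\right)}{\Gamma\left(\frac n2+1\right)}, & n\text{ even}.\end{cases}$$ Then $\lambda_k>\lambda_k^0$ for all $k\ge 0$, and for all integers $n\ge 0$ and all real $s>0$, $$\frac{1}{n+1}\sum_{k=0}^n\left(\lambda_k-\lambda_k^0\right)^{-s}\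 \ge\ \left[\frac{\omega_n}{(n+1)\pi}\int_{\mathbb{R}}q(x)\,dx\right]^{-s}.$$ -/

import Mathlib

open MeasureTheory Filter

/-- The `L²(ℝ)` solutions of the eigenvalue equation `-u'' + V u = μ u` on the real line:
`u` is differentiable, `u'` is locally absolutely continuous (absolutely continuous on every
compact interval), the equation holds almost everywhere, and `u` is square integrable.
The nonzero such `u` are the eigenfunctions of the Schrödinger operator `-d²/dx² + V` on `L²(ℝ)`
for the eigenvalue `μ`. -/
structure IsSchrodingerL2Solution (V : ℝ → ℝ) (μ : ℝ) (u : ℝ → ℝ) : Prop where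
  differentiable : Differentiable ℝ u
  absolutelyContinuous_deriv : ∀ a b : ℝ, AbsolutelyContinuousOnInterval (deriv u) a b
  /-- `u''(x)` exists and `-u''(x) + V(x) u(x) = μ u(x)`, for almost every `x`. -/
  equation : ∀ᵐ x : ℝ, DifferentiableAt ℝ (deriv u) x ∧
    -(deriv (deriv u) x) + V x * u x = μ * u x
  memLp : MemLp u 2 volume

/-- The eigenspace of `-d²/dx² + V` on `L²(ℝ)` for `μ`; it is zero unless `μ` is an eigenvalue. -/
def schrodingerEigenspace (V : ℝ → ℝ) (μ : ℝ) : Submodule ℝ (ℝ → ℝ) where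
  carrier := {u | IsSchrodingerL2Solution V μ u}
  zero_mem' := by
    have h0 : deriv (0 : ℝ → ℝ) = 0 := by ext x; simp
    refine ⟨differentiable_const 0, fun a b => ?_, ?_, MemLp.zero⟩
    · rw [h0]
      exact (contDiff_const (c := (0 : ℝ))).contDiffOn.absolutelyContinuousOnInterval
    · refine Eventually.of_forall fun x => ?_
      rw [h0, h0]
      exact ⟨differentiableAt_const 0, by simp⟩
  add_mem' := by
    intro u v hu hv
    have h : deriv (u + v) = deriv u + deriv v := by
      ext x
      exact deriv_add (hu.differentiable x) (hv.differentiable x)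
    refine ⟨hu.differentiable.add hv.differentiable, fun a b => ?_, ?_, hu.memLp.add hv.memLp⟩
    · rw [h]
      exact (hu.absolutelyContinuous_deriv a b).add (hv.absolutelyContinuous_deriv a b)
    · filter_upwards [hu.equation, hv.equation] with x hx hy
      rw [h]
      refine ⟨hx.1.add hy.1, ?_⟩
      rw [deriv_add hx.1 hy.1, Pi.add_apply]
      linear_combination hx.2 + hy.2
  smul_mem' := by
    intro c u hu
    have h : deriv (c • u) = c • deriv u := by
      ext x
      exact deriv_const_smul c (hu.differentiable x)
    refine ⟨hu.differentiable.const_smul c, fun a b => ?_, ?_, hu.memLp.const_smul c⟩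
    · rw [h]
      exact (hu.absolutelyContinuous_deriv a b).const_smul c
    · filter_upwards [hu.equation] with x hx
      rw [h]
      refine ⟨hx.1.const_smul c, ?_⟩
      rw [deriv_const_smul c hx.1, Pi.smul_apply, smul_eq_mul, smul_eq_mul]
      linear_combination c * hx.2

/-- `lam 0 ≤ lam 1 ≤ … → ∞` is the list of all eigenvalues of `-d²/dx² + V` on `L²(ℝ)`,
each repeated according to its multiplicity: every real number `μ` occurs in the list exactly
as often as the dimension of its eigenspace. -/
structure IsSchrodingerEigenvalueSequence (V : ℝ → ℝ) (lam : ℕ → ℝ) : Prop where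
  monotone : Monotone lam
  tendsto_atTop : Tendsto lam atTop atTop
  multiplicity : ∀ μ : ℝ,
    Cardinal.mk {k : ℕ // lam k = μ} = Module.rank ℝ (schrodingerEigenspace V μ)

/-- The eigenvalues `2 k + 1` of the quantum harmonic oscillator `-u'' + x² u = λ u`. -/
def harmonicEigenvalue (k : ℕ) : ℝ := 2 * (k : ℝ) + 1

/-- The constants `ω_n`, given by quotients of Gamma functions. -/
noncomputable def omegaConst (n : ℕ) : ℝ :=
  if Odd n then
    (2 * (n : ℝ) + 3) / ((n : ℝ) + 1) *
      (Real.Gamma ((n : ℝ) / 2 + 1) / Real.Gamma (((n : ℝ) + 1) / 2))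
  else
    ((n : ℝ) + 1) * (Real.Gamma (((n : ℝ) + 1) / 2) / Real.Gamma ((n : ℝ) / 2 + 1))

open scoped Topology

/-! The inequality is Jensen's inequality applied to a bound on the sum of the first n+1 gaps:
Σ_{k≤n} (λ_k − (2k+1)) ≤ (ω_n/π) ∫ q (`IsSchrodingerEigenbasis.sum_le`).

For this bound, the Hermite functions h_0, …, h_n serve as trial functions. The sum of the n+1
lowest eigenvalues is at most the trace of the form of −d²/dx² + x² + q on their span, which is Σ
(2k+1) + ∫ q Σ h_k². The constant comes from the pointwise bound Σ_{k≤n} h_k² ≤ ω_n/π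
(`sum_hermiteFun_sq_le`). By Christoffel–Darboux, twice this sum plus h_{n+1}² equals E =
(h_{n+1}')² + (2n+3−x²) h_{n+1}². Since E' = −2x h_{n+1}², E is maximal at 0, where it equals
2ω_n/π.

Strict positivity of the gaps is a min-max argument (`two_mul_add_one_lt_of_strictMono`). A
combination of n+1 eigenfunctions orthogonal to h_0, …, h_{n−1} has energy at least (2n+1) times its
squared norm. Equality would force the integral of q against the square of an eigenfunction to
vanish, although an eigenfunction has only countably many zeros.

The spectral theory behind this is built from the quadratic form. Eigenfunctions have finite energy,
eigenvalues are simple because the Wronskian vanishes, and the eigenfunctions are complete because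
the form domain embeds compactly in L²(ℝ). Completeness yields infinitely many eigenvalues and
Parseval's identity; min-max makes them finite in number below every bound, so they can be listed.
-/

theorem LocallyIntegrable.intervalIntegrable_real {g : ℝ → ℝ} (h : LocallyIntegrable g volume)
    (a b : ℝ) : IntervalIntegrable g volume a b :=
  intervalIntegrable_iff.mpr
    ((h.integrableOn_isCompact isCompact_uIcc).mono_set Set.uIoc_subset_uIcc)

/-! ### Calculus of locally absolutely continuous functions on the line -/

/-- `f` is locally absolutely continuous on the line with almost everywhere derivative `g`. -/
structure IsLocalPrimitive (f g : ℝ → ℝ) : Prop where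
  locallyIntegrable : LocallyIntegrable g volume
  sub_eq_integral : ∀ a b : ℝ, f b - f a = ∫ x in a..b, g x

namespace IsLocalPrimitive

variable {f g f₁ g₁ : ℝ → ℝ}

theorem intervalIntegrable (h : IsLocalPrimitive f g) (a b : ℝ) :
    IntervalIntegrable g volume a b :=
  LocallyIntegrable.intervalIntegrable_real h.locallyIntegrable a b

theorem eq_add (h : IsLocalPrimitive f g) (a x : ℝ) : f x = f a + ∫ t in a..x, g t := by
  rw [← h.sub_eq_integral a x]; ring

theorem absolutelyContinuousOnInterval (h : IsLocalPrimitive f g) (a b : ℝ) :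
    AbsolutelyContinuousOnInterval f a b := by
  have h1 := (h.intervalIntegrable a b).absolutelyContinuousOnInterval_intervalIntegral
    (c := a) (by simp)
  have h2 : AbsolutelyContinuousOnInterval (fun _ : ℝ => f a) a b :=
    (contDiff_const (c := f a)).contDiffOn.absolutelyContinuousOnInterval
  have h3 := h2.add h1
  rwa [show f = (fun _ => f a) + fun x => ∫ t in a..x, g t from funext (h.eq_add a)]

theorem ae_hasDerivAt (h : IsLocalPrimitive f g) : ∀ᵐ x, HasDerivAt f (g x) x := by
  filter_upwards [LocallyIntegrable.ae_hasDerivAt_integral h.locallyIntegrable] with x hx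
  have h2 := (hx 0).const_add (f 0)
  rwa [show f = fun y => f 0 + ∫ t in (0 : ℝ)..y, g t from funext (h.eq_add 0)]

theorem continuous (h : IsLocalPrimitive f g) : Continuous f := by
  have : f = fun x => f 0 + ∫ t in (0 : ℝ)..x, g t := by
    ext x; exact h.eq_add 0 x
  rw [this]
  exact continuous_const.add
    (intervalIntegral.continuous_primitive (fun a b => h.intervalIntegrable a b) 0)

theorem hasDerivAt (h : IsLocalPrimitive f g) (hg : Continuous g) (x : ℝ) :
    HasDerivAt f (g x) x := by
  have h2 := (intervalIntegral.integral_hasDerivAt_right (h.intervalIntegrable 0 x)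
    (hg.stronglyMeasurableAtFilter _ _) hg.continuousAt).const_add (f 0)
  rwa [show f = fun y => f 0 + ∫ t in (0 : ℝ)..y, g t from funext (h.eq_add 0)]

theorem congr (h : IsLocalPrimitive f g) (hg : g =ᵐ[volume] g₁) : IsLocalPrimitive f g₁ := by
  refine ⟨h.locallyIntegrable.congr hg, fun a b => ?_⟩
  rw [h.sub_eq_integral]
  exact intervalIntegral.integral_congr_ae (hg.mono fun x hx _ => hx)

theorem of_absolutelyContinuous (h : ∀ a b : ℝ, AbsolutelyContinuousOnInterval f a b) :
    IsLocalPrimitive f (deriv f) := by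
  refine ⟨?_, fun a b => (h a b).integral_deriv_eq_sub.symm⟩
  rw [locallyIntegrable_iff]
  intro k hk
  obtain ⟨R, hR⟩ := hk.isBounded.subset_closedBall 0
  rw [Real.closedBall_eq_Icc] at hR
  rcases le_or_gt (0 - R) (0 + R) with h0 | h0
  · exact ((intervalIntegrable_iff_integrableOn_Icc_of_le h0).1
      (h (0 - R) (0 + R)).intervalIntegrable_deriv).mono_set hR
  · rw [Set.Icc_eq_empty h0.not_ge] at hR
    rw [Set.subset_empty_iff.1 hR]
    exact integrableOn_empty

theorem of_hasDerivAt (h : ∀ x, HasDerivAt f (g x) x) (hg : Continuous g) :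
    IsLocalPrimitive f g :=
  ⟨hg.locallyIntegrable, fun a b =>
    (intervalIntegral.integral_eq_sub_of_hasDerivAt (fun x _ => h x)
      (hg.intervalIntegrable a b)).symm⟩

theorem integral (hg : LocallyIntegrable g volume) (a c : ℝ) :
    IsLocalPrimitive (fun x => c + ∫ t in a..x, g t) g := by
  refine ⟨hg, fun x y => ?_⟩
  rw [add_sub_add_left_eq_sub]
  exact intervalIntegral.integral_interval_sub_left (LocallyIntegrable.intervalIntegrable_real hg _ _)
    (LocallyIntegrable.intervalIntegrable_real hg _ _)

theorem of_ae_eq_of_absolutelyContinuous (hf : ∀ a b : ℝ, AbsolutelyContinuousOnInterval f a b)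
    (hg : ∀ᵐ x, HasDerivAt f (g x) x) : IsLocalPrimitive f g :=
  (of_absolutelyContinuous hf).congr (hg.mono fun _ hx => hx.deriv)

theorem mul (h : IsLocalPrimitive f g) (h₁ : IsLocalPrimitive f₁ g₁) :
    IsLocalPrimitive (fun x => f x * f₁ x) (fun x => g x * f₁ x + f x * g₁ x) := by
  refine of_ae_eq_of_absolutelyContinuous (fun a b =>
    (h.absolutelyContinuousOnInterval a b).mul (h₁.absolutelyContinuousOnInterval a b)) ?_
  filter_upwards [h.ae_hasDerivAt, h₁.ae_hasDerivAt] with x hx hx1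
  exact hx.mul hx1

theorem add (h : IsLocalPrimitive f g) (h₁ : IsLocalPrimitive f₁ g₁) :
    IsLocalPrimitive (fun x => f x + f₁ x) (fun x => g x + g₁ x) := by
  refine ⟨h.locallyIntegrable.add h₁.locallyIntegrable, fun a b => ?_⟩
  rw [intervalIntegral.integral_add (h.intervalIntegrable a b) (h₁.intervalIntegrable a b),
    ← h.sub_eq_integral, ← h₁.sub_eq_integral]
  ring

theorem const_mul (h : IsLocalPrimitive f g) (c : ℝ) :
    IsLocalPrimitive (fun x => c * f x) (fun x => c * g x) := by
  refine ⟨h.locallyIntegrable.smul c, fun a b => ?_⟩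
  rw [intervalIntegral.integral_const_mul, ← h.sub_eq_integral]
  ring

theorem sub (h : IsLocalPrimitive f g) (h₁ : IsLocalPrimitive f₁ g₁) :
    IsLocalPrimitive (fun x => f x - f₁ x) (fun x => g x - g₁ x) := by
  have := h.add (h₁.const_mul (-1))
  simpa [sub_eq_add_neg] using this

theorem id : IsLocalPrimitive (fun x => x) (fun _ => 1) :=
  of_hasDerivAt (fun x => hasDerivAt_id x) continuous_const

theorem comp_neg (h : IsLocalPrimitive f g) :
    IsLocalPrimitive (fun x => f (-x)) (fun x => -g (-x)) := by
  refine of_ae_eq_of_absolutelyContinuous (fun a b => ?_) ?_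
  · have h2 := (h.sub_eq_integral)
    have h3 : LocallyIntegrable (fun x => g (-x)) volume := by
      rw [locallyIntegrable_iff]
      intro k hk
      have hk' := (locallyIntegrable_iff.1 h.locallyIntegrable) (Neg.neg '' k) (hk.image continuous_neg)
      have := (Measure.measurePreserving_neg (volume : Measure ℝ)).integrableOn_comp_preimage
        (Homeomorph.neg ℝ).measurableEmbedding (f := g) (s := Neg.neg '' k)
      have h4 := this.2 hk'
      have h5 : (Neg.neg ⁻¹' (Neg.neg '' k) : Set ℝ) = k := by
        rw [Set.image_neg_eq_neg]; exact neg_neg k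
      rw [h5] at h4
      exact h4
    have h4 := (integral h3 0 0).const_mul (-1)
    have h5 := (h4.add ((of_hasDerivAt (f := fun _ => f 0) (g := fun _ => 0)
      (fun x => hasDerivAt_const x _) continuous_const))).absolutelyContinuousOnInterval a b
    convert h5 using 1
    ext x
    rw [intervalIntegral.integral_comp_neg, neg_zero, h.eq_add 0 (-x),
      intervalIntegral.integral_symm]
    ring
  · have h1 := (Measure.measurePreserving_neg (volume : Measure ℝ)).quasiMeasurePreserving.ae
      h.ae_hasDerivAt
    filter_upwards [h1] with x hx
    have := HasDerivAt.comp x hx (hasDerivAt_neg x)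
    simpa [Function.comp_def] using this

theorem tendsto_atTop (h : IsLocalPrimitive f g) (hg : Integrable g volume) :
    Tendsto f atTop (𝓝 (f 0 + ∫ x in Set.Ioi 0, g x)) := by
  have h1 := (intervalIntegral_tendsto_integral_Ioi 0 hg.integrableOn tendsto_id).const_add (f 0)
  refine h1.congr fun x => ?_
  exact (h.eq_add 0 x).symm

theorem tendsto_atBot (h : IsLocalPrimitive f g) (hg : Integrable g volume) :
    Tendsto f atBot (𝓝 (f 0 - ∫ x in Set.Iic 0, g x)) := by
  have h1 := (intervalIntegral_tendsto_integral_Iic 0 hg.integrableOn tendsto_id).const_sub (f 0)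
  refine h1.congr fun x => ?_
  have := h.sub_eq_integral x 0
  simp only [id_eq]
  linarith

/-- Integrability of the derivative gives a limit; a nonzero limit would contradict integrability of
the function. -/
theorem tendsto_atTop_zero (h : IsLocalPrimitive f g) (hg : Integrable g volume)
    (hf : Integrable f volume) : Tendsto f atTop (𝓝 0) := by
  have h1 := h.tendsto_atTop hg
  have h2 := IntegrableAtFilter.eq_zero_of_tendsto (μ := volume)
    (hf.integrableAtFilter atTop) (fun s hs => by
      obtain ⟨a, ha⟩ := mem_atTop_sets.1 hs
      exact measure_mono_top (s₁ := Set.Ici a) (fun x hx => ha x hx) Real.volume_Ici) h1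
  rwa [h2] at h1

theorem tendsto_atBot_zero (h : IsLocalPrimitive f g) (hg : Integrable g volume)
    (hf : Integrable f volume) : Tendsto f atBot (𝓝 0) := by
  have h1 := h.tendsto_atBot hg
  have h2 := IntegrableAtFilter.eq_zero_of_tendsto (μ := volume)
    (hf.integrableAtFilter atBot) (fun s hs => by
      obtain ⟨a, ha⟩ := mem_atBot_sets.1 hs
      exact measure_mono_top (s₁ := Set.Iic a) (fun x hx => ha x hx) Real.volume_Iic) h1
  rwa [h2] at h1

/-- The boundary terms vanish at ±∞. Applied to products, this is the source of every integration by
parts on the whole line below. -/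
theorem integral_eq_zero (h : IsLocalPrimitive f g) (hg : Integrable g volume)
    (hf : Integrable f volume) : ∫ x, g x = 0 := by
  have h1 := h.tendsto_atTop_zero hg hf
  have h2 := h.tendsto_atBot_zero hg hf
  have h3 := intervalIntegral_tendsto_integral hg tendsto_neg_atTop_atBot tendsto_id
  have h4 : Tendsto (fun x : ℝ => ∫ t in -x..x, g t) atTop (𝓝 (0 - 0)) := by
    have := h1.sub (h2.comp tendsto_neg_atTop_atBot)
    refine this.congr fun x => ?_
    exact h.sub_eq_integral (-x) x
  simpa using tendsto_nhds_unique h3 h4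

theorem exists_bound (h : IsLocalPrimitive f g) (hg : Integrable g volume) :
    ∃ C, ∀ x, |f x| ≤ C := by
  refine ⟨|f 0| + ∫ x, |g x|, fun x => ?_⟩
  rw [h.eq_add 0 x]
  refine (abs_add_le _ _).trans (add_le_add_right ?_ _)
  refine (intervalIntegral.norm_integral_le_integral_norm_uIoc (f := g)).trans ?_
  exact setIntegral_le_integral hg.norm (Eventually.of_forall fun x => norm_nonneg _)

theorem eq_of_ae_eq_zero (h : IsLocalPrimitive f g) (hg : g =ᵐ[volume] 0) (a b : ℝ) :
    f a = f b := by
  have h1 := h.sub_eq_integral a b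
  rw [intervalIntegral.integral_congr_ae (g := fun _ => 0) (hg.mono fun x hx _ => hx)] at h1
  simp at h1
  linarith

end IsLocalPrimitive

/-- A nonnegative function with `|F'| ≤ k F`, `k` locally integrable, vanishes identically as soon
as it vanishes at a point. -/
theorem IsLocalPrimitive.eq_zero_of_abs_le_mul {F G k : ℝ → ℝ} (h : IsLocalPrimitive F G)
    (hF : ∀ x, 0 ≤ F x) (hk : LocallyIntegrable k volume) (hk0 : ∀ x, 0 ≤ k x)
    (hG : ∀ᵐ x, |G x| ≤ k x * F x) {x₀ : ℝ} (hx₀ : F x₀ = 0) (x : ℝ) : F x = 0 := by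
  have hclosed : IsClosed {x | F x = 0} := isClosed_eq h.continuous continuous_const
  have hopen : IsOpen {x | F x = 0} := by
    rw [Metric.isOpen_iff]
    intro y hy
    have hK : Continuous fun x => ∫ t in y..x, k t :=
      intervalIntegral.continuous_primitive (fun a b => (LocallyIntegrable.intervalIntegrable_real hk _ _)) y
    obtain ⟨δ, hδ, hball⟩ := Metric.continuousAt_iff.1 (hK.continuousAt (x := y)) (1 / 2)
      (by norm_num)
    refine ⟨δ / 2, by positivity, ?_⟩
    -- On this interval the integral of `k` from `y` has absolute value below 1/2, so the maximum of
    -- `F` satisfies F z ≤ F z / 2.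
    obtain ⟨z, hz, hmax⟩ := (isCompact_Icc (a := y - δ / 2) (b := y + δ / 2)).exists_isMaxOn
      ⟨y, by constructor <;> linarith⟩ h.continuous.continuousOn
    have hzero : F z = 0 := by
      have h1 := h.sub_eq_integral y z
      have hy' : F y = 0 := hy
      have h2 : |∫ t in y..z, G t| ≤ |∫ t in y..z, k t * F z| := by
        refine intervalIntegral.norm_integral_le_abs_of_norm_le
          (f := G) (g := fun t => k t * F z) ?_ ((LocallyIntegrable.intervalIntegrable_real hk _ _).mul_const _)
        rw [ae_restrict_iff' measurableSet_uIoc]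
        filter_upwards [hG] with t ht htm
        refine ht.trans (mul_le_mul_of_nonneg_left (hmax ?_) (hk0 t))
        have := Set.uIoc_subset_uIcc htm
        exact Set.uIcc_subset_Icc (by constructor <;> linarith) hz this
      rw [intervalIntegral.integral_mul_const, abs_mul, abs_of_nonneg (hF z), ← h1, hy', sub_zero,
        abs_of_nonneg (hF z)] at h2
      have h3 := hball (x := z) (by
        rw [Real.dist_eq, abs_lt]; constructor <;> linarith [hz.1, hz.2])
      rw [Real.dist_eq, intervalIntegral.integral_same, sub_zero] at h3
      nlinarith [hF z]
    intro x hx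
    rw [Metric.mem_ball, Real.dist_eq, abs_lt] at hx
    have := hmax (show x ∈ Set.Icc (y - δ / 2) (y + δ / 2) by constructor <;> linarith)
    exact le_antisymm (this.trans hzero.le) (hF x)
  have := IsClopen.eq_univ ⟨hclosed, hopen⟩ ⟨x₀, hx₀⟩
  exact Set.eq_univ_iff_forall.1 this x

/-- Uniqueness for the initial value problem of `u'' = W u` with locally integrable `W`. -/
theorem eq_zero_of_initial_eq_zero {u v g W : ℝ → ℝ} (hu : IsLocalPrimitive u v)
    (hv : IsLocalPrimitive v g) (hW : LocallyIntegrable W volume)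
    (hg : ∀ᵐ x, g x = W x * u x) {x₀ : ℝ} (h0 : u x₀ = 0) (h1 : v x₀ = 0) (x : ℝ) :
    u x = 0 ∧ v x = 0 := by
  -- F = u² + v² has derivative 2uv(1 + W), and |2uv| ≤ F.
  have hF := (hu.mul hu).add (hv.mul hv)
  have := hF.eq_zero_of_abs_le_mul (k := fun x => 1 + ‖W x‖)
    (fun x => add_nonneg (mul_self_nonneg _) (mul_self_nonneg _))
    ((locallyIntegrable_const 1).add fun x => (hW x).norm) (fun x => by positivity) (by
      filter_upwards [hg] with x hx
      rw [hx, Real.norm_eq_abs]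
      have e : v x * u x + u x * v x + (W x * u x * v x + v x * (W x * u x))
        = (1 + W x) * (2 * u x * v x) := by ring
      rw [e, abs_mul]
      refine mul_le_mul ?_ ?_ (abs_nonneg _) (by positivity)
      · refine (abs_add_le _ _).trans (by simp)
      · rw [abs_le]; constructor <;> nlinarith [sq_nonneg (u x + v x), sq_nonneg (u x - v x)])
    (x₀ := x₀) (by simp [h0, h1]) x
  constructor <;> nlinarith [mul_self_nonneg (u x), mul_self_nonneg (v x)]

theorem MeasureTheory.MemLp.integrable_fun_mul {f g : ℝ → ℝ} (hf : MemLp f 2 volume)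
    (hg : MemLp g 2 volume) : Integrable (fun x => f x * g x) volume :=
  hf.integrable_mul hg

/-! ### Hermite functions: raising, lowering and recurrence -/

section HermiteFunctions

open Polynomial

/-- The normalized Hermite polynomials (physicists' convention), defined by the raising
operator. -/
noncomputable def normalizedHermite : ℕ → ℝ[X]
  | 0 => C (√(√Real.pi))⁻¹
  | k + 1 => C (√(2 * (k + 1 : ℝ)))⁻¹ *
      (2 * X * normalizedHermite k - derivative (normalizedHermite k))

/-- By induction: the lowering relation at level k together with the raising definition gives
Hermite's differential equation (`h5`), which is what differentiating the next raising step
requires. -/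
theorem derivative_normalizedHermite_succ (k : ℕ) :
    derivative (normalizedHermite (k + 1)) = C (√(2 * (k + 1 : ℝ))) * normalizedHermite k := by
  have key : ∀ (k : ℕ) (s : ℝ), 0 < s → s * s = 2 * (k + 1 : ℝ) →
      (∀ p : ℝ[X], C s⁻¹ * (2 * p + 2 * (C (k : ℝ)) * p) = C s * p) := by
    intro k s hs h2 p
    have : s⁻¹ * (2 + 2 * (k : ℝ)) = s := by
      field_simp; nlinarith
    calc C s⁻¹ * (2 * p + 2 * (C (k : ℝ)) * p) = C (s⁻¹ * (2 + 2 * (k : ℝ))) * p := by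
          simp only [C_mul, C_add, map_ofNat]; ring
      _ = _ := by rw [this]
  induction k with
  | zero =>
    have := key 0 (√(2 * ((0 : ℕ) + 1 : ℝ))) (by positivity) (Real.mul_self_sqrt (by positivity))
      (normalizedHermite 0)
    rw [← this]
    simp [normalizedHermite]
  | succ k ih =>
    have := key (k + 1) (√(2 * ((k + 1 : ℕ) + 1 : ℝ))) (by positivity) (Real.mul_self_sqrt (by positivity))
      (normalizedHermite (k + 1))
    rw [← this, normalizedHermite]
    have h2 : C (√(2 * (k + 1 : ℝ))) * C (√(2 * (k + 1 : ℝ)))⁻¹ = (1 : ℝ[X]) := by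
      rw [← C_mul, mul_inv_cancel₀ (by positivity), C_1]
    have h3 : (C (√(2 * (k + 1 : ℝ))) : ℝ[X]) * C (√(2 * (k + 1 : ℝ))) = 2 * (C (k : ℝ) + 1) := by
      rw [← C_mul, Real.mul_self_sqrt (by positivity)]
      simp only [C_mul, C_add, C_1, map_ofNat]
    have h4 : C (√(2 * (k + 1 : ℝ))) * normalizedHermite (k + 1)
        = 2 * X * normalizedHermite k - derivative (normalizedHermite k) := by
      rw [normalizedHermite, ← mul_assoc, h2, one_mul]
    have h5 : 2 * X * derivative (normalizedHermite (k + 1))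
        - derivative (derivative (normalizedHermite (k + 1)))
        = 2 * (C (k : ℝ) + 1) * normalizedHermite (k + 1) := by
      rw [ih, derivative_C_mul, ← h3, mul_assoc (C _) (C _), h4]
      ring
    simp only [derivative_mul, derivative_sub, derivative_C, derivative_X, derivative_ofNat]
    push_cast
    simp only [C_add, C_1]
    linear_combination C (√(2 * ((k : ℝ) + 1 + 1)))⁻¹ * h5

/-- The Hermite functions, an orthonormal basis of `L²(ℝ)`. -/
noncomputable def hermiteFun (k : ℕ) (x : ℝ) : ℝ :=
  (normalizedHermite k).eval x * Real.exp (-(1 / 2) * x ^ 2)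

theorem hasDerivAt_gaussian (x : ℝ) : HasDerivAt (fun x : ℝ => Real.exp (-(1 / 2) * x ^ 2))
    (-x * Real.exp (-(1 / 2) * x ^ 2)) x := by
  have := ((hasDerivAt_pow 2 x).const_mul (-(1 / 2) : ℝ)).exp
  convert! this using 1
  simp; ring

theorem hermiteFun_zero (x : ℝ) :
    hermiteFun 0 x = (√(√Real.pi))⁻¹ * Real.exp (-(1 / 2) * x ^ 2) := by
  simp [hermiteFun, normalizedHermite]

theorem hasDerivAt_hermiteFun (k : ℕ) (x : ℝ) : HasDerivAt (hermiteFun k)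
    (x * hermiteFun k x - √(2 * (k + 1 : ℝ)) * hermiteFun (k + 1) x) x := by
  have := ((normalizedHermite k).hasDerivAt x).mul (hasDerivAt_gaussian x)
  convert! this using 1
  have hs : √(2 * (k + 1 : ℝ)) ≠ 0 := by positivity
  simp only [hermiteFun, normalizedHermite, eval_mul, eval_C, eval_sub, eval_X, eval_ofNat]
  field_simp
  ring

theorem hasDerivAt_hermiteFun_succ (k : ℕ) (x : ℝ) : HasDerivAt (hermiteFun (k + 1))
    (-x * hermiteFun (k + 1) x + √(2 * (k + 1 : ℝ)) * hermiteFun k x) x := by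
  have := ((normalizedHermite (k + 1)).hasDerivAt x).mul (hasDerivAt_gaussian x)
  convert! this using 1
  rw [derivative_normalizedHermite_succ]
  simp only [hermiteFun, eval_mul, eval_C]
  ring

theorem hasDerivAt_hermiteFun_zero (x : ℝ) :
    HasDerivAt (hermiteFun 0) (-x * hermiteFun 0 x) x := by
  have := ((normalizedHermite 0).hasDerivAt x).mul (hasDerivAt_gaussian x)
  convert! this using 1
  simp only [hermiteFun, normalizedHermite, derivative_C, eval_zero]
  ring

theorem hermiteFun_one (x : ℝ) : √2 * hermiteFun 1 x = 2 * x * hermiteFun 0 x := by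
  have := (hasDerivAt_hermiteFun 0 x).unique (hasDerivAt_hermiteFun_zero x)
  norm_num at this
  linarith

/-- The raising and the lowering formula compute the same derivative of `hermiteFun (k + 1)`. -/
theorem hermiteFun_recurrence (k : ℕ) (x : ℝ) :
    √(2 * (k + 2 : ℝ)) * hermiteFun (k + 2) x =
      2 * x * hermiteFun (k + 1) x - √(2 * (k + 1 : ℝ)) * hermiteFun k x := by
  have := (hasDerivAt_hermiteFun (k + 1) x).unique (hasDerivAt_hermiteFun_succ k x)
  push_cast at this
  rw [show (k : ℝ) + 1 + 1 = k + 2 by ring] at this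
  linarith

theorem integrable_polynomial_mul_gaussian (p : ℝ[X]) {b : ℝ} (hb : 0 < b) :
    Integrable (fun x : ℝ => p.eval x * Real.exp (-b * x ^ 2)) volume := by
  induction p using Polynomial.induction_on' with
  | add p q hp hq =>
    simp only [eval_add, add_mul]
    exact hp.add hq
  | monomial n a =>
    simp only [eval_monomial, mul_assoc]
    refine Integrable.const_mul ?_ a
    have := integrable_rpow_mul_exp_neg_mul_sq hb (s := n) (by
      have : (0 : ℝ) ≤ n := n.cast_nonneg
      linarith)
    simpa using this

theorem memLp_polynomial_mul_gaussian (p : ℝ[X]) :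
    MemLp (fun x : ℝ => p.eval x * Real.exp (-(1 / 2) * x ^ 2)) 2 volume := by
  refine (memLp_two_iff_integrable_sq ?_).2 ?_
  · exact (by fun_prop : Continuous fun x : ℝ => p.eval x * Real.exp (-(1 / 2) * x ^ 2))
      |>.aestronglyMeasurable
  · convert integrable_polynomial_mul_gaussian (p ^ 2) one_pos using 2 with x
    rw [mul_pow, ← Real.exp_nat_mul, eval_pow]
    congr 2
    push_cast; ring

theorem memLp_hermiteFun (k : ℕ) : MemLp (hermiteFun k) 2 volume :=
  memLp_polynomial_mul_gaussian _

theorem memLp_id_mul_hermiteFun (k : ℕ) : MemLp (fun x => x * hermiteFun k x) 2 volume := by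
  convert memLp_polynomial_mul_gaussian (X * normalizedHermite k) using 2 with x
  simp [hermiteFun]; ring

theorem continuous_hermiteFun (k : ℕ) : Continuous (hermiteFun k) := by
  unfold hermiteFun
  fun_prop

end HermiteFunctions

/-! ### The form domain and orthonormality of the Hermite functions -/

/-- The form domain of the harmonic oscillator: `u` is locally absolutely continuous with
derivative `v`, and `u`, `v` and `x u` are square integrable. -/
structure HarmonicFormDomain (u v : ℝ → ℝ) : Prop where
  prim : IsLocalPrimitive u v
  memLp : MemLp u 2 volume
  memLp_deriv : MemLp v 2 volume
  memLp_id_mul : MemLp (fun x => x * u x) 2 volume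

/-- The derivatives of the Hermite functions. -/
noncomputable def hermiteFunDeriv (k : ℕ) (x : ℝ) : ℝ :=
  x * hermiteFun k x - √(2 * (k + 1 : ℝ)) * hermiteFun (k + 1) x

theorem continuous_hermiteFunDeriv (k : ℕ) : Continuous (hermiteFunDeriv k) := by
  have h1 := continuous_hermiteFun k
  have h2 := continuous_hermiteFun (k + 1)
  unfold hermiteFunDeriv
  fun_prop

theorem harmonicFormDomain_hermiteFun (k : ℕ) :
    HarmonicFormDomain (hermiteFun k) (hermiteFunDeriv k) where
  prim := .of_hasDerivAt (hasDerivAt_hermiteFun k) (continuous_hermiteFunDeriv k)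
  memLp := memLp_hermiteFun k
  memLp_deriv := (memLp_id_mul_hermiteFun k).sub ((memLp_hermiteFun (k + 1)).const_mul _)
  memLp_id_mul := memLp_id_mul_hermiteFun k

theorem hermiteFunDeriv_succ (k : ℕ) (x : ℝ) : hermiteFunDeriv (k + 1) x =
    -x * hermiteFun (k + 1) x + √(2 * (k + 1 : ℝ)) * hermiteFun k x :=
  (hasDerivAt_hermiteFun (k + 1) x).unique (hasDerivAt_hermiteFun_succ k x)

theorem hermiteFunDeriv_zero (x : ℝ) : hermiteFunDeriv 0 x = -x * hermiteFun 0 x :=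
  (hasDerivAt_hermiteFun 0 x).unique (hasDerivAt_hermiteFun_zero x)

namespace HarmonicFormDomain

variable {u v u₁ v₁ : ℝ → ℝ}

theorem continuous (h : HarmonicFormDomain u v) : Continuous u := h.prim.continuous

/-- Integration by parts in the form domain. -/
theorem integral_deriv_mul (h : HarmonicFormDomain u v) (h₁ : HarmonicFormDomain u₁ v₁) :
    ∫ x, v x * u₁ x = -∫ x, u x * v₁ x := by
  have e1 := h.memLp_deriv.integrable_fun_mul h₁.memLp
  have e2 := h.memLp.integrable_fun_mul h₁.memLp_deriv
  have := (h.prim.mul h₁.prim).integral_eq_zero (e1.add e2) (h.memLp.integrable_fun_mul h₁.memLp)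
  rw [integral_add e1 e2] at this
  linarith

/-- The lowering operator acts on Hermite coefficients as a weighted shift. -/
theorem integral_lowering_mul_hermiteFun (h : HarmonicFormDomain u v) (k : ℕ) :
    ∫ x, (v x + x * u x) * hermiteFun k x =
      √(2 * (k + 1 : ℝ)) * ∫ x, u x * hermiteFun (k + 1) x := by
  have h1 := h.integral_deriv_mul (harmonicFormDomain_hermiteFun k)
  have e1 := h.memLp_deriv.integrable_fun_mul (memLp_hermiteFun k)
  have e2 := h.memLp_id_mul.integrable_fun_mul (memLp_hermiteFun k)
  have e3 := h.memLp.integrable_fun_mul (memLp_hermiteFun (k + 1))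
  have e : ∀ x, u x * hermiteFunDeriv k x = (x * u x) * hermiteFun k x -
      √(2 * (k + 1 : ℝ)) * (u x * hermiteFun (k + 1) x) := fun x => by
    rw [hermiteFunDeriv]; ring
  simp_rw [e, add_mul] at h1 ⊢
  rw [integral_sub e2 (e3.const_mul _), integral_const_mul] at h1
  rw [integral_add e1 e2, h1]
  ring

end HarmonicFormDomain

/-- Lowering the left factor equals raising the right one, which moves a Gram matrix entry along its
diagonal. -/
theorem integral_hermiteFun_succ_mul (k : ℕ) (j : ℕ) :
    √(2 * (j + 1 : ℝ)) * ∫ x, hermiteFun (k + 1) x * hermiteFun (j + 1) x =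
      √(2 * (k + 1 : ℝ)) * ∫ x, hermiteFun k x * hermiteFun j x := by
  rw [← (harmonicFormDomain_hermiteFun (k + 1)).integral_lowering_mul_hermiteFun j,
    ← integral_const_mul]
  congr 1 with x
  rw [hermiteFunDeriv_succ]; ring

/-- The lowering operator annihilates the Gaussian. -/
theorem integral_hermiteFun_zero_mul_succ (j : ℕ) :
    ∫ x, hermiteFun 0 x * hermiteFun (j + 1) x = 0 := by
  have := (harmonicFormDomain_hermiteFun 0).integral_lowering_mul_hermiteFun j
  have e : ∀ x, hermiteFunDeriv 0 x + x * hermiteFun 0 x = 0 := fun x => by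
    rw [hermiteFunDeriv_zero]; ring
  simp_rw [e] at this
  simp only [zero_mul, integral_zero] at this
  have hs : √(2 * (j + 1 : ℝ)) ≠ 0 := by positivity
  exact (mul_eq_zero.1 this.symm).resolve_left hs

theorem integral_hermiteFun_mul_hermiteFun (k j : ℕ) :
    ∫ x, hermiteFun k x * hermiteFun j x = if k = j then 1 else 0 := by
  induction k generalizing j with
  | zero =>
    cases j with
    | zero =>
      have : ∀ x, hermiteFun 0 x * hermiteFun 0 x = (√Real.pi)⁻¹ * Real.exp (-1 * x ^ 2) := by
        intro x
        have h2 : (√(√Real.pi))⁻¹ * (√(√Real.pi))⁻¹ = (√Real.pi)⁻¹ := by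
          rw [← mul_inv, Real.mul_self_sqrt (Real.sqrt_nonneg _)]
        have h3 : Real.exp (-(1 / 2) * x ^ 2) * Real.exp (-(1 / 2) * x ^ 2)
            = Real.exp (-1 * x ^ 2) := by rw [← Real.exp_add]; congr 1; ring
        rw [hermiteFun_zero, ← h2, ← h3]; ring
      simp_rw [this]
      rw [integral_const_mul, integral_gaussian]
      simp [Real.sqrt_ne_zero'.2 Real.pi_pos]
    | succ j => simp [integral_hermiteFun_zero_mul_succ j]
  | succ k ih =>
    cases j with
    | zero =>
      simp_rw [mul_comm (hermiteFun (k + 1) _)]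
      simp [integral_hermiteFun_zero_mul_succ k]
    | succ j =>
      have h := integral_hermiteFun_succ_mul k j
      rw [ih j] at h
      have hs : √(2 * (j + 1 : ℝ)) ≠ 0 := by positivity
      by_cases hkj : k = j
      · subst hkj
        rw [if_pos rfl, mul_one] at h
        rw [if_pos rfl]
        exact mul_left_cancel₀ hs (by rw [h, mul_one])
      · simp only [hkj, if_false, mul_zero, mul_eq_zero, hs, false_or] at h
        simp [hkj, h]

/-! ### The pointwise bound that produces `omegaConst` -/

/-- Christoffel–Darboux formula on the diagonal. -/
theorem two_mul_sum_hermiteFun_sq (n : ℕ) (x : ℝ) :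
    2 * ∑ k ∈ Finset.range (n + 1), hermiteFun k x ^ 2 =
      2 * (n + 1 : ℝ) * (hermiteFun n x ^ 2 + hermiteFun (n + 1) x ^ 2) -
        2 * x * (√(2 * (n + 1 : ℝ)) * hermiteFun n x * hermiteFun (n + 1) x) := by
  induction n with
  | zero =>
    have h := hermiteFun_one x
    have h2 : √2 * √2 = (2 : ℝ) := Real.mul_self_sqrt (by norm_num)
    have h3 : 2 * hermiteFun 1 x = √2 * (2 * x * hermiteFun 0 x) := by
      rw [← h, ← mul_assoc, h2]
    simp only [Finset.range_one, Finset.sum_singleton, zero_add, Nat.cast_zero, mul_one]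
    linear_combination (-hermiteFun 1 x) * h3
  | succ n ih =>
    rw [Finset.sum_range_succ, mul_add, ih]
    have h := hermiteFun_recurrence n x
    have hs : √(2 * (n + 1 : ℝ)) * √(2 * (n + 1 : ℝ)) = 2 * (n + 1 : ℝ) :=
      Real.mul_self_sqrt (by positivity)
    have hs2 : √(2 * (n + 2 : ℝ)) * √(2 * (n + 2 : ℝ)) = 2 * (n + 2 : ℝ) :=
      Real.mul_self_sqrt (by positivity)
    push_cast
    rw [show (n : ℝ) + 1 + 1 = n + 2 by ring]
    generalize √(2 * (n + 1 : ℝ)) = s at *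
    generalize √(2 * (n + 2 : ℝ)) = t at *
    linear_combination (s * hermiteFun n x - t * hermiteFun (n + 2) x) * h -
      hermiteFun n x ^ 2 * hs + hermiteFun (n + 2) x ^ 2 * hs2

/-- The Sonin-type energy of `hermiteFun (n + 1)` is maximal at the origin. -/
theorem hermiteFun_energy_le (n : ℕ) (x : ℝ) :
    hermiteFunDeriv (n + 1) x ^ 2 + (2 * n + 3 - x ^ 2) * hermiteFun (n + 1) x ^ 2 ≤
      2 * (n + 1) * hermiteFun n 0 ^ 2 + (2 * n + 3) * hermiteFun (n + 1) 0 ^ 2 := by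
  have hs : √(2 * (n + 1 : ℝ)) * √(2 * (n + 1 : ℝ)) = 2 * (n + 1 : ℝ) :=
    Real.mul_self_sqrt (by positivity)
  let E : ℝ → ℝ := fun x => (-x * hermiteFun (n + 1) x + √(2 * (n + 1 : ℝ)) * hermiteFun n x) ^ 2
    + (2 * n + 3 - x ^ 2) * hermiteFun (n + 1) x ^ 2
  -- For h = `hermiteFun (n + 1)` one has h'' = (x² − (2n+3)) h, so the terms containing h' cancel
  -- and only the derivative of the coefficient −x² survives.
  have hE : ∀ x, HasDerivAt E (-2 * x * hermiteFun (n + 1) x ^ 2) x := by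
    intro x
    have h1 := hasDerivAt_hermiteFun_succ n x
    have h0 := hasDerivAt_hermiteFun n x
    have h := (((hasDerivAt_neg x).mul h1).add (h0.const_mul (√(2 * (n + 1 : ℝ))))).pow 2 |>.add
      ((((hasDerivAt_pow 2 x).const_sub (2 * n + 3 : ℝ))).mul (h1.pow 2))
    convert! h using 1
    generalize √(2 * (n + 1 : ℝ)) = s at *
    simp
    linear_combination (-(2 * (-x * hermiteFun (n + 1) x + s * hermiteFun n x)
      * hermiteFun (n + 1) x)) * -hs
  have hdiff : Differentiable ℝ E := fun x => (hE x).differentiableAt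
  have key : E x ≤ E 0 := by
    rcases le_total 0 x with hx | hx
    · refine antitoneOn_of_deriv_nonpos (convex_Ici (0 : ℝ)) hdiff.continuous.continuousOn
        hdiff.differentiableOn (fun y hy => ?_) (Set.self_mem_Ici) hx hx
      rw [(hE y).deriv]
      rw [interior_Ici] at hy
      have : 0 < y := hy
      nlinarith [mul_nonneg this.le (sq_nonneg (hermiteFun (n + 1) y))]
    · refine monotoneOn_of_deriv_nonneg (convex_Iic (0 : ℝ)) hdiff.continuous.continuousOn
        hdiff.differentiableOn (fun y hy => ?_) hx (Set.self_mem_Iic) hx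
      rw [(hE y).deriv]
      rw [interior_Iic] at hy
      have : y < 0 := hy
      nlinarith [mul_nonneg (neg_nonneg.2 this.le) (sq_nonneg (hermiteFun (n + 1) y))]
  rw [hermiteFunDeriv_succ]
  refine key.trans (le_of_eq ?_)
  simp only [E, neg_zero, zero_mul, zero_add]
  rw [mul_pow, pow_two (√_), hs]
  ring

/-- At the origin the middle term of the recurrence disappears. The odd values stay zero, and the
even squares obey a two-step recursion matched by the functional equation of Gamma. -/
theorem hermiteFun_zero_sq (m : ℕ) : hermiteFun (2 * m + 1) 0 = 0 ∧
    hermiteFun (2 * m) 0 ^ 2 =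
      Real.Gamma ((m : ℝ) + 1 / 2) / (Real.pi * Real.Gamma ((m : ℝ) + 1)) := by
  induction m with
  | zero =>
    constructor
    · have := hermiteFun_one 0
      simpa using this
    · have hp : √Real.pi ≠ 0 := Real.sqrt_ne_zero'.2 Real.pi_pos
      have h : √Real.pi * √Real.pi = Real.pi := Real.mul_self_sqrt Real.pi_pos.le
      simp only [mul_zero, hermiteFun_zero]
      simp only [Nat.cast_zero, zero_add, Real.Gamma_one, Real.Gamma_one_half_eq]
      rw [mul_pow, inv_pow, Real.sq_sqrt (Real.sqrt_nonneg _)]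
      simp
      field_simp
      exact (Real.sq_sqrt Real.pi_pos.le).symm
  | succ m ih =>
    constructor
    · have h := hermiteFun_recurrence (2 * m + 1) 0
      rw [ih.1] at h
      simp only [mul_zero, zero_mul, sub_zero] at h
      exact (mul_eq_zero.1 h).resolve_left (by positivity)
    · have h := hermiteFun_recurrence (2 * m) 0
      have h2 : (√(2 * ((2 * m : ℕ) + 2 : ℝ)) * hermiteFun (2 * m + 2) 0) ^ 2
          = (√(2 * ((2 * m : ℕ) + 1 : ℝ)) * hermiteFun (2 * m) 0) ^ 2 := by
        rw [h]; ring
      rw [mul_pow, mul_pow, Real.sq_sqrt (by positivity), Real.sq_sqrt (by positivity), ih.2] at h2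
      have g1 : Real.Gamma ((m : ℝ) + 1 + 1 / 2) = (m + 1 / 2) * Real.Gamma ((m : ℝ) + 1 / 2) := by
        rw [← Real.Gamma_add_one (by positivity)]; congr 1; ring
      have g2 : Real.Gamma ((m : ℝ) + 1 + 1) = (m + 1) * Real.Gamma ((m : ℝ) + 1) :=
        Real.Gamma_add_one (by positivity)
      have g3 : Real.Gamma ((m : ℝ) + 1) ≠ 0 := (Real.Gamma_pos_of_pos (by positivity)).ne'
      have hp := Real.pi_pos.ne'
      rw [show 2 * (m + 1) = 2 * m + 2 by ring]
      push_cast at h2 ⊢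
      rw [g1, g2]
      field_simp at h2 ⊢
      linarith

/-- The Christoffel–Darboux expression is the Sonin energy minus `hermiteFun (n + 1) x ^ 2`, so the
energy bound at the origin controls it. -/
theorem sum_hermiteFun_sq_le (n : ℕ) (x : ℝ) :
    ∑ k ∈ Finset.range (n + 1), hermiteFun k x ^ 2 ≤ omegaConst n / Real.pi := by
  have h1 := two_mul_sum_hermiteFun_sq n x
  have h2 := hermiteFun_energy_le n x
  have hs : √(2 * (n + 1 : ℝ)) * √(2 * (n + 1 : ℝ)) = 2 * (n + 1 : ℝ) :=
    Real.mul_self_sqrt (by positivity)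
  rw [hermiteFunDeriv_succ] at h2
  have h3 : 2 * ∑ k ∈ Finset.range (n + 1), hermiteFun k x ^ 2 ≤
      2 * (n + 1) * hermiteFun n 0 ^ 2 + (2 * n + 3) * hermiteFun (n + 1) 0 ^ 2 := by
    rw [h1]
    have e : (-x * hermiteFun (n + 1) x + √(2 * (n + 1 : ℝ)) * hermiteFun n x) ^ 2 +
        (2 * n + 3 - x ^ 2) * hermiteFun (n + 1) x ^ 2 =
        2 * (n + 1 : ℝ) * (hermiteFun n x ^ 2 + hermiteFun (n + 1) x ^ 2) -
        2 * x * (√(2 * (n + 1 : ℝ)) * hermiteFun n x * hermiteFun (n + 1) x) +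
        hermiteFun (n + 1) x ^ 2 := by
      linear_combination hermiteFun n x ^ 2 * hs
    linarith [sq_nonneg (hermiteFun (n + 1) x)]
  have hp := Real.pi_pos.ne'
  suffices h : 2 * (n + 1) * hermiteFun n 0 ^ 2 + (2 * n + 3) * hermiteFun (n + 1) 0 ^ 2 =
      2 * (omegaConst n / Real.pi) by linarith
  -- Exactly one of the two values at the origin survives, depending on parity; hence the two cases
  -- in `omegaConst`.
  rcases Nat.even_or_odd' n with ⟨m, rfl | rfl⟩
  · have hodd : ¬ Odd (2 * m) := by simp
    have g3 : Real.Gamma ((m : ℝ) + 1) ≠ 0 := (Real.Gamma_pos_of_pos (by positivity)).ne'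
    rw [omegaConst, if_neg hodd, (hermiteFun_zero_sq m).1, (hermiteFun_zero_sq m).2]
    push_cast
    rw [show (2 * (m : ℝ) + 1) / 2 = m + 1 / 2 by ring, show 2 * (m : ℝ) / 2 + 1 = m + 1 by ring]
    field_simp
    ring
  · have hodd : Odd (2 * m + 1) := ⟨m, rfl⟩
    have g3 : Real.Gamma ((m : ℝ) + 1) ≠ 0 := (Real.Gamma_pos_of_pos (by positivity)).ne'
    have g2 : Real.Gamma ((m : ℝ) + 1 + 1) = (m + 1) * Real.Gamma ((m : ℝ) + 1) :=
      Real.Gamma_add_one (by positivity)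
    rw [omegaConst, if_pos hodd, (hermiteFun_zero_sq m).1,
      show 2 * m + 1 + 1 = 2 * (m + 1) by ring, (hermiteFun_zero_sq (m + 1)).2]
    push_cast
    rw [show (2 * (m : ℝ) + 1) / 2 + 1 = m + 1 + 1 / 2 by ring,
      show (2 * (m : ℝ) + 1 + 1) / 2 = m + 1 by ring, g2]
    field_simp
    ring

/-! ### Completeness of the Hermite functions -/

/-- Multiplication by x sends a Hermite function to a combination of its neighbours, so powers of x
can be removed one at a time. -/
theorem integral_mul_pow_mul_hermiteFun_eq_zero {f : ℝ → ℝ} (hf : MemLp f 2 volume)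
    (h : ∀ k, ∫ x, f x * hermiteFun k x = 0) (m k : ℕ) :
    ∫ x, f x * (x ^ m * hermiteFun k x) = 0 := by
  have hint : ∀ m k, Integrable (fun x => f x * (x ^ m * hermiteFun k x)) volume := fun m k => by
    refine hf.integrable_fun_mul ?_
    convert! memLp_polynomial_mul_gaussian (Polynomial.X ^ m * normalizedHermite k) using 2 with x
    simp [hermiteFun]; ring
  induction m generalizing k with
  | zero => simpa using h k
  | succ m ih =>
    cases k with
    | zero =>
      have e : ∀ x, f x * (x ^ (m + 1) * hermiteFun 0 x) =
          √2 / 2 * (f x * (x ^ m * hermiteFun 1 x)) := fun x => by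
        linear_combination (- f x * x ^ m / 2) * hermiteFun_one x
      simp_rw [e]
      rw [integral_const_mul, ih, mul_zero]
    | succ k =>
      have e : ∀ x, f x * (x ^ (m + 1) * hermiteFun (k + 1) x) =
          √(2 * (k + 2 : ℝ)) / 2 * (f x * (x ^ m * hermiteFun (k + 2) x)) +
          √(2 * (k + 1 : ℝ)) / 2 * (f x * (x ^ m * hermiteFun k x)) := fun x => by
        linear_combination (- f x * x ^ m / 2) * hermiteFun_recurrence k x
      simp_rw [e]
      rw [integral_add ((hint m _).const_mul _) ((hint m _).const_mul _), integral_const_mul,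
        integral_const_mul, ih, ih]
      simp

/-- The finite measures with densities F⁺ and F⁻ have the same characteristic function, hence
coincide. -/
theorem Integrable.ae_eq_zero_of_integral_cexp_eq_zero {F : ℝ → ℝ} (hF : Integrable F volume)
    (h : ∀ t : ℝ, ∫ x, (F x : ℂ) * Complex.exp (t * x * Complex.I) = 0) : F =ᵐ[volume] 0 := by
  have : IsFiniteMeasure (volume.withDensity fun x => ENNReal.ofReal (F x)) :=
    isFiniteMeasure_withDensity_ofReal hF.2
  have : IsFiniteMeasure (volume.withDensity fun x => ENNReal.ofReal (-F x)) :=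
    isFiniteMeasure_withDensity_ofReal hF.neg.2
  have hFn : AEMeasurable (fun x => -F x) volume := hF.aemeasurable.neg
  have key : (volume.withDensity fun x => ENNReal.ofReal (F x)) =
      volume.withDensity fun x => ENNReal.ofReal (-F x) := by
    refine Measure.ext_of_charFun ?_
    ext t
    rw [charFun_apply_real, charFun_apply_real,
      integral_withDensity_eq_integral_toReal_smul₀ hF.aemeasurable.ennreal_ofReal
        (by simp), integral_withDensity_eq_integral_toReal_smul₀
        hFn.ennreal_ofReal (by simp), ← sub_eq_zero]
    have hb : ∀ G : ℝ → ℝ, Integrable G volume →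
        Integrable (fun x => (ENNReal.ofReal (G x)).toReal • Complex.exp (t * x * Complex.I))
          volume := by
      intro G hG
      have h1 : Integrable (fun x => ((max (G x) 0 : ℝ) : ℂ)) volume := hG.pos_part.ofReal
      have h2 := h1.mul_bdd (c := 1) (g := fun x : ℝ => Complex.exp (t * x * Complex.I))
        (by fun_prop) (Eventually.of_forall fun x => by
          rw [← Complex.ofReal_mul, Complex.norm_exp_ofReal_mul_I])
      refine h2.congr (Eventually.of_forall fun x => ?_)
      simp [ENNReal.toReal_ofReal']
    rw [← integral_sub (hb F hF) (hb (fun x => -F x) hF.neg), ← h t]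
    congr 1 with x
    rw [← sub_smul, ENNReal.toReal_ofReal', ENNReal.toReal_ofReal', max_comm, max_comm (-F x),
      Complex.real_smul]
    congr 2
    rcases le_total 0 (F x) with h0 | h0
    · rw [max_eq_right h0, max_eq_left (by linarith)]; ring
    · rw [max_eq_left h0, max_eq_right (by linarith)]; ring
  rw [withDensity_eq_iff_of_sigmaFinite hF.aemeasurable.ennreal_ofReal
    hFn.ennreal_ofReal] at key
  filter_upwards [key] with x hx
  have := congrArg ENNReal.toReal hx
  rw [ENNReal.toReal_ofReal', ENNReal.toReal_ofReal'] at this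
  rcases le_total 0 (F x) with h0 | h0
  · rw [max_eq_left h0, max_eq_right (by linarith)] at this; simpa using this
  · rw [max_eq_right h0, max_eq_left (by linarith)] at this; simp; linarith

/-- Completeness of the Hermite functions in `L²(ℝ)`. -/
theorem ae_eq_zero_of_forall_integral_mul_hermiteFun_eq_zero {f : ℝ → ℝ} (hf : MemLp f 2 volume)
    (h : ∀ k, ∫ x, f x * hermiteFun k x = 0) : f =ᵐ[volume] 0 := by
  have hgauss : ∀ t : ℝ, MemLp (fun x : ℝ => Real.exp (|t * x|) * Real.exp (-(1 / 2) * x ^ 2)) 2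
      volume := by
    intro t
    have hc : Continuous fun x : ℝ => Real.exp (|t * x|) * Real.exp (-(1 / 2) * x ^ 2) := by
      fun_prop
    refine (memLp_two_iff_integrable_sq hc.aestronglyMeasurable).2 ?_
    refine Integrable.mono' ((integrable_exp_neg_mul_sq (b := 1 / 2) (by norm_num)).const_mul
      (Real.exp (2 * t ^ 2))) (hc.pow 2).aestronglyMeasurable (Eventually.of_forall fun x => ?_)
    rw [Real.norm_of_nonneg (by positivity), ← Real.exp_add, ← Real.exp_add, ← Real.exp_nat_mul,
      Real.exp_le_exp]
    push_cast
    -- After squaring, the exponent 2|tx| − x² is at most 2t² − x²/2, which is the chosen Gaussian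
    -- majorant.
    have : |t * x| ≤ t ^ 2 + x ^ 2 / 4 := by
      rw [abs_le]; constructor <;> nlinarith [sq_nonneg (t + x / 2), sq_nonneg (t - x / 2)]
    nlinarith
  have hF : Integrable (fun x => f x * Real.exp (-(1 / 2) * x ^ 2)) volume := by
    have := hf.integrable_fun_mul (hgauss 0)
    simpa using this
  have hm : ∀ m : ℕ, ∫ x, f x * (x ^ m * Real.exp (-(1 / 2) * x ^ 2)) = 0 := by
    intro m
    have h1 := integral_mul_pow_mul_hermiteFun_eq_zero hf h m 0
    have e : ∀ x, f x * (x ^ m * hermiteFun 0 x) =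
        (√(√Real.pi))⁻¹ * (f x * (x ^ m * Real.exp (-(1 / 2) * x ^ 2))) := fun x => by
      rw [hermiteFun_zero]; ring
    simp_rw [e] at h1
    rw [integral_const_mul] at h1
    have hp : (√(√Real.pi))⁻¹ ≠ 0 := by
      have := Real.pi_pos
      positivity
    exact (mul_eq_zero.1 h1).resolve_left hp
  -- The exponential is expanded in powers and integrated termwise. The majorant |f| e^{|tx| − x²/2}
  -- is integrable, and each term is a multiple of a vanishing moment.
  have h0 := Integrable.ae_eq_zero_of_integral_cexp_eq_zero hF (fun t => by
    have hs := hasSum_integral_of_dominated_convergence (μ := volume)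
      (F := fun (n : ℕ) (x : ℝ) => ((f x * Real.exp (-(1 / 2) * x ^ 2) : ℝ) : ℂ) *
        ((t * x * Complex.I) ^ n / n.factorial))
      (f := fun x => ((f x * Real.exp (-(1 / 2) * x ^ 2) : ℝ) : ℂ) *
        Complex.exp (t * x * Complex.I))
      (fun n x => |f x * Real.exp (-(1 / 2) * x ^ 2)| * (|t * x| ^ n / n.factorial))
      (fun n => (Complex.continuous_ofReal.comp_aestronglyMeasurable hF.aestronglyMeasurable).mul
        (by fun_prop : Continuous fun x : ℝ => ((t * x * Complex.I) ^ n / n.factorial : ℂ)).aestronglyMeasurable)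
      (fun n => Eventually.of_forall fun x => by
        rw [norm_mul, norm_div, norm_pow, norm_mul, Complex.norm_I, mul_one, ← Complex.ofReal_mul,
          Complex.norm_real, Complex.norm_real, Complex.norm_natCast, Real.norm_eq_abs,
          Real.norm_eq_abs])
      (Eventually.of_forall fun x => (Real.summable_pow_div_factorial _).mul_left _)
      (by
        have h1 := (hf.integrable_fun_mul (hgauss t)).norm
        refine h1.congr (Eventually.of_forall fun x => ?_)
        simp only
        rw [tsum_mul_left, (NormedSpace.expSeries_div_hasSum_exp (𝔸 := ℝ) |t * x|).tsum_eq,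
          ← Real.exp_eq_exp_ℝ, ← abs_of_pos (Real.exp_pos |t * x|), ← abs_mul, Real.norm_eq_abs]
        congr 1
        rw [abs_of_pos (Real.exp_pos |t * x|)]
        ring)
      (Eventually.of_forall fun x => by
        have := NormedSpace.expSeries_div_hasSum_exp (𝔸 := ℂ) (t * x * Complex.I)
        rw [← Complex.exp_eq_exp_ℂ] at this
        exact this.mul_left _)
    refine hs.unique ?_
    convert hasSum_zero with n
    have e : ∀ x : ℝ, ((f x * Real.exp (-(1 / 2) * x ^ 2) : ℝ) : ℂ) *
        ((t * x * Complex.I) ^ n / n.factorial) = ((t * Complex.I) ^ n / n.factorial : ℂ) *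
          ((f x * (x ^ n * Real.exp (-(1 / 2) * x ^ 2)) : ℝ) : ℂ) := fun x => by
      push_cast; ring
    simp_rw [e]
    rw [integral_const_mul, integral_complex_ofReal, hm n]
    simp)
  filter_upwards [h0] with x hx
  simpa [Real.exp_ne_zero] using hx

theorem inner_toLp_toLp {f g : ℝ → ℝ} (hf : MemLp f 2 volume) (hg : MemLp g 2 volume) :
    inner ℝ (hf.toLp f) (hg.toLp g) = ∫ x, f x * g x := by
  rw [L2.inner_def]
  refine integral_congr_ae ?_
  filter_upwards [hf.coeFn_toLp, hg.coeFn_toLp] with x h1 h2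
  rw [h1, h2]
  simp [mul_comm]

/-- The Hermite functions as elements of `L²(ℝ)`. -/
noncomputable def hermiteLp (k : ℕ) : Lp ℝ 2 (volume : Measure ℝ) := (memLp_hermiteFun k).toLp _

theorem orthonormal_hermiteLp : Orthonormal ℝ hermiteLp := by
  rw [orthonormal_iff_ite]
  intro i j
  rw [hermiteLp, hermiteLp, inner_toLp_toLp, integral_hermiteFun_mul_hermiteFun]

theorem eq_zero_of_forall_inner_hermiteLp_eq_zero (f : Lp ℝ 2 (volume : Measure ℝ))
    (h : ∀ k, inner ℝ (hermiteLp k) f = 0) : f = 0 := by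
  have h1 := ae_eq_zero_of_forall_integral_mul_hermiteFun_eq_zero (Lp.memLp f) (fun k => by
    rw [← inner_toLp_toLp (Lp.memLp f) (memLp_hermiteFun k), Lp.toLp_coeFn, real_inner_comm]
    exact h k)
  exact (Lp.eq_zero_iff_ae_eq_zero).2 h1

/-- The Hermite functions as a Hilbert basis of `L²(ℝ)`. -/
noncomputable def hermiteBasis : HilbertBasis ℕ ℝ (Lp ℝ 2 (volume : Measure ℝ)) :=
  HilbertBasis.mkOfOrthogonalEqBot orthonormal_hermiteLp (by
    rw [Submodule.eq_bot_iff]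
    intro f hf
    refine eq_zero_of_forall_inner_hermiteLp_eq_zero f fun k => ?_
    exact (Submodule.mem_orthogonal _ _).1 hf _ (Submodule.subset_span ⟨k, rfl⟩))

theorem hasSum_sq_integral_mul_hermiteFun {f : ℝ → ℝ} (hf : MemLp f 2 volume) :
    HasSum (fun k => (∫ x, f x * hermiteFun k x) ^ 2) (∫ x, f x ^ 2) := by
  have h := hermiteBasis.hasSum_inner_mul_inner (hf.toLp f) (hf.toLp f)
  simp only [hermiteBasis, HilbertBasis.coe_mkOfOrthogonalEqBot] at h
  rw [inner_toLp_toLp hf hf] at h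
  simp_rw [← pow_two] at h
  convert! h using 2 with k
  rw [real_inner_comm (hf.toLp f), ← pow_two, hermiteLp, inner_toLp_toLp]

theorem sum_sq_integral_mul_hermiteFun_le {f : ℝ → ℝ} (hf : MemLp f 2 volume) (s : Finset ℕ) :
    ∑ k ∈ s, (∫ x, f x * hermiteFun k x) ^ 2 ≤ ∫ x, f x ^ 2 :=
  sum_le_hasSum s (fun _ _ => sq_nonneg _) (hasSum_sq_integral_mul_hermiteFun hf)

/-! ### Energy estimates for the harmonic oscillator -/

namespace HarmonicFormDomain

variable {u v u₁ v₁ : ℝ → ℝ}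

theorem add (h : HarmonicFormDomain u v) (h₁ : HarmonicFormDomain u₁ v₁) :
    HarmonicFormDomain (fun x => u x + u₁ x) (fun x => v x + v₁ x) where
  prim := h.prim.add h₁.prim
  memLp := h.memLp.add h₁.memLp
  memLp_deriv := h.memLp_deriv.add h₁.memLp_deriv
  memLp_id_mul := by
    convert! h.memLp_id_mul.add h₁.memLp_id_mul using 2 with x
    simp [mul_add]

theorem const_mul (h : HarmonicFormDomain u v) (c : ℝ) :
    HarmonicFormDomain (fun x => c * u x) (fun x => c * v x) where
  prim := h.prim.const_mul c
  memLp := h.memLp.const_mul c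
  memLp_deriv := h.memLp_deriv.const_mul c
  memLp_id_mul := by
    convert! h.memLp_id_mul.const_mul c using 2 with x
    ring

theorem zero : HarmonicFormDomain (fun _ => 0) (fun _ => 0) where
  prim := .of_hasDerivAt (fun x => hasDerivAt_const x 0) continuous_const
  memLp := MemLp.zero
  memLp_deriv := MemLp.zero
  memLp_id_mul := by simp

theorem sum {ι : Type*} (s : Finset ι) {u v : ι → ℝ → ℝ}
    (h : ∀ i ∈ s, HarmonicFormDomain (u i) (v i)) :
    HarmonicFormDomain (fun x => ∑ i ∈ s, u i x) (fun x => ∑ i ∈ s, v i x) := by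
  classical
  induction s using Finset.induction_on with
  | empty => simpa using zero
  | insert a s ha ih =>
    simp_rw [Finset.sum_insert ha]
    exact (h a (Finset.mem_insert_self a s)).add
      (ih fun i hi => h i (Finset.mem_insert_of_mem hi))

theorem exists_bound (h : HarmonicFormDomain u v) : ∃ C, ∀ x, |u x| ≤ C := by
  obtain ⟨C, hC⟩ := (h.prim.mul h.prim).exists_bound
    ((h.memLp_deriv.integrable_fun_mul h.memLp).add (h.memLp.integrable_fun_mul h.memLp_deriv))
  refine ⟨√C, fun x => Real.le_sqrt_of_sq_le ?_⟩
  rw [pow_two, ← abs_mul]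
  exact hC x

theorem integrable_mul_mul {q : ℝ → ℝ} (h : HarmonicFormDomain u v)
    (h₁ : HarmonicFormDomain u₁ v₁) (hq : Integrable q volume) :
    Integrable (fun x => q x * (u x * u₁ x)) volume := by
  obtain ⟨C, hC⟩ := h.exists_bound
  obtain ⟨D, hD⟩ := h₁.exists_bound
  refine hq.mul_bdd (c := C * D) (h.continuous.mul h₁.continuous).aestronglyMeasurable
    (Eventually.of_forall fun x => ?_)
  rw [norm_mul]
  exact mul_le_mul (hC x) (hD x) (abs_nonneg _) ((abs_nonneg _).trans (hC x))

/-- The cross term 2xuv equals (x u²)' − u², and the total derivative integrates to zero. -/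
theorem integral_lowering_sq (h : HarmonicFormDomain u v) :
    ∫ x, (v x + x * u x) ^ 2 = (∫ x, v x ^ 2) + (∫ x, (x * u x) ^ 2) - ∫ x, u x ^ 2 := by
  have e1 := h.memLp_deriv.integrable_sq
  have e2 := h.memLp_id_mul.integrable_sq
  have e3 := h.memLp.integrable_sq
  have e4 := h.memLp_deriv.integrable_fun_mul h.memLp_id_mul
  have e5 := h.memLp_id_mul.integrable_fun_mul h.memLp
  have p := IsLocalPrimitive.id.mul (h.prim.mul h.prim)
  have ez : (fun x => 1 * (u x * u x) + x * (v x * u x + u x * v x)) =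
      fun x => u x ^ 2 + 2 * (v x * (x * u x)) := by ext x; ring
  rw [ez] at p
  have hz := p.integral_eq_zero (e3.add (e4.const_mul 2))
    (e5.congr (Eventually.of_forall fun x => by simp only; ring))
  rw [integral_add e3 (e4.const_mul 2), integral_const_mul] at hz
  have ea : ∀ x, (v x + x * u x) ^ 2 = v x ^ 2 + (x * u x) ^ 2 + 2 * (v x * (x * u x)) :=
    fun x => by ring
  simp_rw [ea]
  have e12 : Integrable (fun x => v x ^ 2 + (x * u x) ^ 2) volume := e1.add e2
  rw [integral_add e12 (e4.const_mul 2), integral_add e1 e2, integral_const_mul]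
  linarith

/-- Spectral lower bound for the quadratic form of the harmonic oscillator. -/
theorem energy_ge (h : HarmonicFormDomain u v) (N : ℕ) :
    (∫ x, u x ^ 2) + 2 * N * ((∫ x, u x ^ 2) -
        ∑ k ∈ Finset.range N, (∫ x, u x * hermiteFun k x) ^ 2) ≤
      (∫ x, v x ^ 2) + ∫ x, (x * u x) ^ 2 := by
  have ha : MemLp (fun x => v x + x * u x) 2 volume := h.memLp_deriv.add h.memLp_id_mul
  -- Let c_k be the Hermite coefficients of `u`. Those of v + xu are √(2(k+1)) c_{k+1}, so Bessel
  -- bounds Σ 2k c_k² by the energy minus ‖u‖². Indices below N are dropped and k ≥ N is used in the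
  -- rest; Parseval then lets M → ∞.
  have key : ∀ M ≥ N, 2 * N * ((∑ k ∈ Finset.range (M + 1), (∫ x, u x * hermiteFun k x) ^ 2) -
        ∑ k ∈ Finset.range N, (∫ x, u x * hermiteFun k x) ^ 2) ≤
      (∫ x, v x ^ 2) + (∫ x, (x * u x) ^ 2) - ∫ x, u x ^ 2 := by
    intro M hM
    rw [← h.integral_lowering_sq]
    refine le_trans ?_ (sum_sq_integral_mul_hermiteFun_le ha (Finset.range M))
    simp_rw [h.integral_lowering_mul_hermiteFun, mul_pow]
    have e : ∀ k : ℕ, √(2 * (k + 1 : ℝ)) ^ 2 = 2 * ((k + 1 : ℕ) : ℝ) := fun k => by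
      rw [Real.sq_sqrt (by positivity)]; push_cast; ring
    simp_rw [e]
    have e2 := Finset.sum_range_succ' (fun k : ℕ => 2 * (k : ℝ) *
      (∫ x, u x * hermiteFun k x) ^ 2) M
    simp only [Nat.cast_zero, mul_zero, zero_mul, add_zero] at e2
    rw [← e2, ← Finset.sum_range_add_sum_Ico _ (show N ≤ M + 1 by omega), add_sub_cancel_left,
      ← Finset.sum_range_add_sum_Ico _ (show N ≤ M + 1 by omega), Finset.mul_sum]
    refine le_trans (Finset.sum_le_sum fun k hk => ?_)
      (le_add_of_nonneg_left (Finset.sum_nonneg fun k _ => by positivity))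
    have : (N : ℝ) ≤ k := by exact_mod_cast (Finset.mem_Ico.1 hk).1
    gcongr
  have hlim := (((hasSum_sq_integral_mul_hermiteFun h.memLp).tendsto_sum_nat.comp
    (tendsto_add_atTop_nat 1)).sub_const
      (∑ k ∈ Finset.range N, (∫ x, u x * hermiteFun k x) ^ 2)).const_mul (2 * N : ℝ)
  have := le_of_tendsto hlim (eventually_atTop.2 ⟨N, fun M hM => key M hM⟩)
  linarith

end HarmonicFormDomain

theorem hermiteFun_energy (k : ℕ) :
    (∫ x, hermiteFunDeriv k x ^ 2) + (∫ x, (x * hermiteFun k x) ^ 2) = 2 * k + 1 := by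
  have h := (harmonicFormDomain_hermiteFun k).integral_lowering_sq
  have h1 := integral_hermiteFun_mul_hermiteFun k k
  simp only [if_true, ← pow_two] at h1
  rw [h1] at h
  suffices h2 : ∫ x, (hermiteFunDeriv k x + x * hermiteFun k x) ^ 2 = 2 * k by linarith
  cases k with
  | zero => simp [hermiteFunDeriv_zero]
  | succ k =>
    have e : ∀ x, (hermiteFunDeriv (k + 1) x + x * hermiteFun (k + 1) x) ^ 2 =
        2 * (k + 1) * (hermiteFun k x * hermiteFun k x) := fun x => by
      rw [hermiteFunDeriv_succ]
      have hs : √(2 * (k + 1 : ℝ)) * √(2 * (k + 1 : ℝ)) = 2 * (k + 1 : ℝ) :=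
        Real.mul_self_sqrt (by positivity)
      linear_combination (hermiteFun k x * hermiteFun k x) * hs
    simp_rw [e]
    rw [integral_const_mul, integral_hermiteFun_mul_hermiteFun]
    simp

/-! ### Square-integrable solutions have finite energy -/

/-- The integrand is (uv)' + μu². If its increasing integrals over [0, R] were unbounded, then uv ≥
1 eventually, so (u²)' ≥ 2 and u could not be square integrable. -/
theorem IsLocalPrimitive.integrableOn_Ioi_energy {u v g : ℝ → ℝ} {μ : ℝ}
    (hu : IsLocalPrimitive u v) (hv : IsLocalPrimitive v g)
    (hu2 : Integrable (fun x => u x ^ 2) volume)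
    (hP : ∀ᵐ x, 0 ≤ v x ^ 2 + g x * u x + μ * u x ^ 2) :
    IntegrableOn (fun x => v x ^ 2 + g x * u x + μ * u x ^ 2) (Set.Ioi 0) volume := by
  have hvu := hv.mul hu
  have hPl : LocallyIntegrable (fun x => v x ^ 2 + g x * u x + μ * u x ^ 2) volume := by
    have := hvu.locallyIntegrable.add (hu2.const_mul μ).locallyIntegrable
    convert! this using 2 with x
    simp; ring
  have hint : ∀ R, ∫ x in (0 : ℝ)..R, (v x ^ 2 + g x * u x + μ * u x ^ 2) =
      v R * u R - v 0 * u 0 + μ * ∫ x in (0 : ℝ)..R, u x ^ 2 := by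
    intro R
    rw [hvu.sub_eq_integral, ← intervalIntegral.integral_const_mul,
      ← intervalIntegral.integral_add (hvu.intervalIntegrable _ _)
        (hu2.const_mul μ).intervalIntegrable]
    congr 1 with x
    ring
  have hu2R : ∀ R, 0 ≤ R → |μ * ∫ x in (0 : ℝ)..R, u x ^ 2| ≤ |μ| * ∫ x, u x ^ 2 := by
    intro R hR
    rw [abs_mul]
    refine mul_le_mul_of_nonneg_left ?_ (abs_nonneg _)
    rw [intervalIntegral.integral_of_le hR, abs_of_nonneg (by positivity)]
    exact setIntegral_le_integral hu2 (Eventually.of_forall fun x => sq_nonneg _)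
  have hmono : ∀ R S, 0 ≤ R → R ≤ S → ∫ x in (0 : ℝ)..R, (v x ^ 2 + g x * u x + μ * u x ^ 2) ≤
      ∫ x in (0 : ℝ)..S, (v x ^ 2 + g x * u x + μ * u x ^ 2) := by
    intro R S hR hRS
    rw [intervalIntegral.integral_of_le hR, intervalIntegral.integral_of_le (hR.trans hRS)]
    refine setIntegral_mono_set ?_ (ae_restrict_of_ae hP)
      (Set.Ioc_subset_Ioc_right hRS).eventuallyLE
    exact (hPl.integrableOn_isCompact isCompact_Icc).mono_set Set.Ioc_subset_Icc_self
  -- The bound is chosen so that exceeding it once forces v R · u R ≥ 1 from then on.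
  have hbdd : ∀ R, 0 ≤ R → ∫ x in (0 : ℝ)..R, (v x ^ 2 + g x * u x + μ * u x ^ 2) ≤
      1 - v 0 * u 0 + |μ| * ∫ x, u x ^ 2 := by
    by_contra! hcon
    obtain ⟨R₀, hR₀, hlt⟩ := hcon
    have h1 : ∀ R, R₀ ≤ R → 1 ≤ v R * u R := by
      intro R hR
      have e1 := hmono R₀ R hR₀ hR
      have e2 := hint R
      have e3 := abs_le.1 (hu2R R (hR₀.trans hR))
      linarith [e3.2]
    have h2 : ∀ R, R₀ + 1 ≤ R → 1 ≤ u R ^ 2 := by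
      intro R hR
      have e := (hu.mul hu).sub_eq_integral R₀ R
      have e2 : ∫ x in R₀..R, (2 : ℝ) ≤ ∫ x in R₀..R, (v x * u x + u x * v x) := by
        refine intervalIntegral.integral_mono_on (by linarith) (by simp)
          ((hu.mul hu).intervalIntegrable _ _) fun x hx => ?_
        linarith [h1 x hx.1, mul_comm (u x) (v x)]
      rw [intervalIntegral.integral_const, smul_eq_mul] at e2
      nlinarith [mul_self_nonneg (u R₀)]
    have h3 : IntegrableOn (fun _ : ℝ => (1 : ℝ)) (Set.Ici (R₀ + 1)) volume := by
      refine (hu2.integrableOn (s := Set.Ici (R₀ + 1))).mono' aestronglyMeasurable_const ?_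
      rw [ae_restrict_iff' measurableSet_Ici]
      refine Eventually.of_forall fun x hx => ?_
      simpa using h2 x hx
    rw [integrableOn_const_iff] at h3
    simp at h3
  refine integrableOn_Ioi_of_intervalIntegral_norm_bounded
    (1 - v 0 * u 0 + |μ| * ∫ x, u x ^ 2) 0 (fun R : ℝ =>
      (hPl.integrableOn_isCompact isCompact_Icc).mono_set Set.Ioc_subset_Icc_self) tendsto_id ?_
  filter_upwards [eventually_ge_atTop (0 : ℝ)] with R hR
  refine le_trans (le_of_eq ?_) (hbdd R hR)
  refine intervalIntegral.integral_congr_ae (hP.mono fun x hx _ => ?_)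
  exact Real.norm_of_nonneg hx

theorem IsLocalPrimitive.integrable_energy {u v g : ℝ → ℝ} {μ : ℝ}
    (hu : IsLocalPrimitive u v) (hv : IsLocalPrimitive v g)
    (hu2 : Integrable (fun x => u x ^ 2) volume)
    (hP : ∀ᵐ x, 0 ≤ v x ^ 2 + g x * u x + μ * u x ^ 2) :
    Integrable (fun x => v x ^ 2 + g x * u x + μ * u x ^ 2) volume := by
  have h1 := hu.integrableOn_Ioi_energy hv hu2 hP
  have hmp := Measure.measurePreserving_neg (volume : Measure ℝ)
  have hv' : IsLocalPrimitive (fun x => -v (-x)) (fun x => g (-x)) := by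
    have := hv.comp_neg.const_mul (-1)
    simpa using this
  have h2 := hu.comp_neg.integrableOn_Ioi_energy (μ := μ) hv' hu2.comp_neg (by
    filter_upwards [hmp.quasiMeasurePreserving.ae hP] with x hx
    simpa using hx)
  have h3 := (hmp.integrableOn_comp_preimage (Homeomorph.neg ℝ).measurableEmbedding
    (f := fun x => v x ^ 2 + g x * u x + μ * u x ^ 2) (s := Set.Iio 0)).1 (by
      convert! h2 using 2
      · simp
      · simp)
  have h4 : IntegrableOn (fun x => v x ^ 2 + g x * u x + μ * u x ^ 2) (Set.Iio 0 ∪ Set.Ici 0)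
    volume := h3.union ((integrableOn_Ici_iff_integrableOn_Ioi (by simp)).2 h1)
  rwa [Set.Iio_union_Ici, integrableOn_univ] at h4

/-! ### The quadratic form, weak equation and simplicity of eigenvalues -/

/-- The quadratic form of `-d²/dx² + x² + q`; `v` and `v₁` are the derivatives of `u`, `u₁`. -/
noncomputable def schrodingerForm (q u v u₁ v₁ : ℝ → ℝ) : ℝ :=
  ∫ x, (v x * v₁ x + (x * u x) * (x * u₁ x) + q x * (u x * u₁ x))

theorem locallyIntegrable_mul_continuous {f g : ℝ → ℝ} (hf : LocallyIntegrable f volume)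
    (hg : Continuous g) : LocallyIntegrable (fun x => f x * g x) volume := by
  rw [locallyIntegrable_iff]
  intro k hk
  exact ((locallyIntegrable_iff.1 hf) k hk).mul_continuousOn hg.continuousOn hk

theorem locallyIntegrable_potential_mul {q u : ℝ → ℝ} (hq : Integrable q volume) (μ : ℝ)
    (hu : Continuous u) : LocallyIntegrable (fun x => (x ^ 2 + q x - μ) * u x) volume := by
  have h1 : LocallyIntegrable (fun x : ℝ => (x ^ 2 - μ) * u x) volume :=
    (by fun_prop : Continuous fun x : ℝ => (x ^ 2 - μ) * u x).locallyIntegrable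
  have h2 : LocallyIntegrable (fun x : ℝ => q x * u x) volume :=
    locallyIntegrable_mul_continuous hq.locallyIntegrable hu
  convert! h1.add h2 using 2 with x
  simp; ring

theorem HarmonicFormDomain.integrable_form {q u v u₁ v₁ : ℝ → ℝ} (hq : Integrable q volume)
    (h : HarmonicFormDomain u v) (h₁ : HarmonicFormDomain u₁ v₁) :
    Integrable (fun x => v x * v₁ x + (x * u x) * (x * u₁ x) + q x * (u x * u₁ x)) volume :=
  ((h.memLp_deriv.integrable_fun_mul h₁.memLp_deriv).add
    (h.memLp_id_mul.integrable_fun_mul h₁.memLp_id_mul)).add (h.integrable_mul_mul h₁ hq)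

namespace IsSchrodingerL2Solution

variable {q u u₁ : ℝ → ℝ} {μ : ℝ}

theorem prim_deriv (h : IsSchrodingerL2Solution (fun x => x ^ 2 + q x) μ u) :
    IsLocalPrimitive (deriv u) (fun x => (x ^ 2 + q x - μ) * u x) := by
  refine (IsLocalPrimitive.of_absolutelyContinuous h.absolutelyContinuous_deriv).congr ?_
  filter_upwards [h.equation] with x hx
  linarith [hx.2]

theorem prim (h : IsSchrodingerL2Solution (fun x => x ^ 2 + q x) μ u) :
    IsLocalPrimitive u (deriv u) :=
  .of_hasDerivAt (fun x => (h.differentiable x).hasDerivAt) h.prim_deriv.continuous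

/-- By the equation, the integrable energy density is u'² + (xu)² + qu². All three terms are
nonnegative, so each of the first two is dominated by the whole. -/
theorem harmonicFormDomain (hq0 : ∀ᵐ x, 0 ≤ q x)
    (h : IsSchrodingerL2Solution (fun x => x ^ 2 + q x) μ u) :
    HarmonicFormDomain u (deriv u) := by
  have hc := h.prim_deriv.continuous
  have huc := h.prim.continuous
  have e : ∀ x, deriv u x ^ 2 + (x ^ 2 + q x - μ) * u x * u x + μ * u x ^ 2 =
      deriv u x ^ 2 + (x * u x) ^ 2 + q x * u x ^ 2 := fun x => by ring
  have hP := h.prim.integrable_energy h.prim_deriv (μ := μ) h.memLp.integrable_sq (by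
    filter_upwards [hq0] with x hx
    rw [e]; positivity)
  simp_rw [e] at hP
  refine ⟨h.prim, h.memLp, ?_, ?_⟩
  · refine (memLp_two_iff_integrable_sq hc.aestronglyMeasurable).2
      (hP.mono' (hc.pow 2).aestronglyMeasurable ?_)
    filter_upwards [hq0] with x hx
    rw [Real.norm_of_nonneg (by positivity)]
    nlinarith [mul_nonneg hx (sq_nonneg (u x)), sq_nonneg (x * u x)]
  · have hcx : Continuous fun x => x * u x := by fun_prop
    refine (memLp_two_iff_integrable_sq hcx.aestronglyMeasurable).2
      (hP.mono' (hcx.pow 2).aestronglyMeasurable ?_)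
    filter_upwards [hq0] with x hx
    rw [Real.norm_of_nonneg (by positivity)]
    nlinarith [mul_nonneg hx (sq_nonneg (u x)), sq_nonneg (deriv u x)]

/-- Eigenfunctions satisfy the weak form of the eigenvalue equation. -/
theorem schrodingerForm_eq (hq : Integrable q volume) (hq0 : ∀ᵐ x, 0 ≤ q x)
    (h : IsSchrodingerL2Solution (fun x => x ^ 2 + q x) μ u) {φ ψ : ℝ → ℝ}
    (hφ : HarmonicFormDomain φ ψ) :
    schrodingerForm q u (deriv u) φ ψ = μ * ∫ x, u x * φ x := by
  have hd := h.harmonicFormDomain hq0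
  have h1 := hd.integrable_form hq hφ
  have h2 := hd.memLp.integrable_fun_mul hφ.memLp
  have hp := h.prim_deriv.mul hφ.prim
  have e : (fun x => (x ^ 2 + q x - μ) * u x * φ x + deriv u x * ψ x) = fun x =>
      (deriv u x * ψ x + (x * u x) * (x * φ x) + q x * (u x * φ x)) - μ * (u x * φ x) := by
    ext x; ring
  rw [e] at hp
  have := hp.integral_eq_zero (h1.sub (h2.const_mul μ)) (hd.memLp_deriv.integrable_fun_mul hφ.memLp)
  rw [integral_sub h1 (h2.const_mul μ), integral_const_mul] at this
  rw [schrodingerForm]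
  linarith

theorem eq_zero_of_initial (hq : Integrable q volume)
    (h : IsSchrodingerL2Solution (fun x => x ^ 2 + q x) μ u) {x₀ : ℝ} (h0 : u x₀ = 0)
    (h1 : deriv u x₀ = 0) : u = 0 := by
  ext x
  refine (eq_zero_of_initial_eq_zero h.prim h.prim_deriv (W := fun x => x ^ 2 + q x - μ) ?_
    (Eventually.of_forall fun x => rfl) h0 h1 x).1
  simpa using locallyIntegrable_potential_mul hq μ continuous_one

/-- Eigenvalues on the line are simple. -/
theorem exists_smul_eq (hq : Integrable q volume) (hq0 : ∀ᵐ x, 0 ≤ q x)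
    (h : IsSchrodingerL2Solution (fun x => x ^ 2 + q x) μ u)
    (h₁ : IsSchrodingerL2Solution (fun x => x ^ 2 + q x) μ u₁) (hu : u ≠ 0) :
    ∃ c : ℝ, c • u = u₁ := by
  -- The Wronskian is constant because its derivative vanishes, and it is integrable as a
  -- combination of products of L² functions; so it tends to 0 and is 0.
  have hW : u 0 * deriv u₁ 0 = u₁ 0 * deriv u 0 := by
    have hp := (h.prim.mul h₁.prim_deriv).sub (h₁.prim.mul h.prim_deriv)
    have hc := hp.eq_of_ae_eq_zero (Eventually.of_forall fun x => by
      simp only [Pi.zero_apply]; ring)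
    have hz := hp.tendsto_atTop_zero (by
        convert! integrable_zero ℝ ℝ volume using 2 with x
        simp only [Pi.zero_apply]
        ring)
      (((h.harmonicFormDomain hq0).memLp.integrable_fun_mul
        (h₁.harmonicFormDomain hq0).memLp_deriv).sub
        ((h₁.harmonicFormDomain hq0).memLp.integrable_fun_mul
        (h.harmonicFormDomain hq0).memLp_deriv))
    have := tendsto_nhds_unique hz (tendsto_const_nhds.congr fun x => hc 0 x)
    linarith
  -- A combination with zero initial data vanishes identically; the zero Wronskian supplies such
  -- coefficients.
  have key : ∀ a b : ℝ, a * u 0 + b * u₁ 0 = 0 → a * deriv u 0 + b * deriv u₁ 0 = 0 →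
      a • u + b • u₁ = 0 := by
    intro a b e1 e2
    have hs : IsSchrodingerL2Solution (fun x => x ^ 2 + q x) μ (a • u + b • u₁) :=
      (schrodingerEigenspace _ μ).add_mem ((schrodingerEigenspace _ μ).smul_mem a h)
        ((schrodingerEigenspace _ μ).smul_mem b h₁)
    refine hs.eq_zero_of_initial hq (x₀ := 0) e1 ?_
    have hd := ((h.differentiable 0).hasDerivAt.const_smul a).add
      ((h₁.differentiable 0).hasDerivAt.const_smul b)
    rw [hd.deriv]
    simpa using e2
  by_cases h0 : u 0 = 0
  · have h1 : deriv u 0 ≠ 0 := fun h1 => hu (h.eq_zero_of_initial hq h0 h1)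
    have h2 := key (deriv u₁ 0) (-deriv u 0) (by
      rw [h0] at hW ⊢
      linarith) (by ring)
    refine ⟨(deriv u 0)⁻¹ * deriv u₁ 0, ?_⟩
    ext x
    have := congrFun h2 x
    simp only [Pi.add_apply, Pi.smul_apply, smul_eq_mul, Pi.zero_apply] at this ⊢
    field_simp
    linarith
  · have h2 := key (u₁ 0) (-u 0) (by ring) (by linarith)
    refine ⟨(u 0)⁻¹ * u₁ 0, ?_⟩
    ext x
    have := congrFun h2 x
    simp only [Pi.add_apply, Pi.smul_apply, smul_eq_mul, Pi.zero_apply] at this ⊢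
    field_simp
    linarith

theorem rank_eigenspace_le_one (hq : Integrable q volume) (hq0 : ∀ᵐ x, 0 ≤ q x) (μ : ℝ) :
    Module.rank ℝ (schrodingerEigenspace (fun x => x ^ 2 + q x) μ) ≤ 1 := by
  rw [rank_submodule_le_one_iff']
  by_cases h : ∃ u, IsSchrodingerL2Solution (fun x => x ^ 2 + q x) μ u ∧ u ≠ 0
  · obtain ⟨u, hu, hu0⟩ := h
    refine ⟨u, fun w hw => ?_⟩
    obtain ⟨c, hc⟩ := hu.exists_smul_eq hq hq0 hw hu0
    exact Submodule.mem_span_singleton.2 ⟨c, hc⟩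
  · push Not at h
    refine ⟨0, fun w hw => ?_⟩
    rw [h w hw]
    exact Submodule.zero_mem _

end IsSchrodingerL2Solution

/-! ### Regularity of weak solutions -/

/-- Elements of the form domain that satisfy the weak eigenvalue equation are eigenfunctions. -/
theorem HarmonicFormDomain.isSchrodingerL2Solution {q u v : ℝ → ℝ} {μ : ℝ}
    (hq : Integrable q volume) (h : HarmonicFormDomain u v)
    (hweak : ∀ φ ψ, HarmonicFormDomain φ ψ → schrodingerForm q u v φ ψ = μ * ∫ x, u x * φ x) :
    IsSchrodingerL2Solution (fun x => x ^ 2 + q x) μ u := by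
  have hWl := locallyIntegrable_potential_mul hq μ h.continuous
  set W : ℝ → ℝ := fun x => (x ^ 2 + q x - μ) * u x with hWdef
  have hw := IsLocalPrimitive.integral hWl 0 0
  set w : ℝ → ℝ := fun x => 0 + ∫ t in (0 : ℝ)..x, W t with hwdef
  have hwc : Continuous w := hw.continuous
  -- The du Bois-Reymond lemma: `w` is a primitive of the weak second derivative, so v − w has to be
  -- almost everywhere constant on each interval.
  have local_eq : ∀ a b : ℝ, a < b → ∃ m : ℝ, ∀ᵐ x, x ∈ Set.Ioc a b → v x = w x + m := by
    intro a b hab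
    have hvi : IntervalIntegrable v volume a b := h.prim.intervalIntegrable a b
    set m : ℝ := (∫ x in a..b, (v x - w x)) / (b - a) with hm
    refine ⟨m, ?_⟩
    -- Subtracting the mean `m` gives `p` integral zero, so its primitive `φ` is supported in [a, b]
    -- and is an admissible test function with derivative `p`.
    set p : ℝ → ℝ := (Set.Ioc a b).indicator (fun x => v x - w x - m) with hp
    have hpL2 : MemLp p 2 volume := by
      have h1 : MemLp ((Set.Ioc a b).indicator v) 2 volume := h.memLp_deriv.indicator measurableSet_Ioc
      have h2 : MemLp ((Set.Ioc a b).indicator fun x => w x + m) 2 volume := by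
        rw [memLp_indicator_iff_restrict measurableSet_Ioc]
        have hc : Continuous fun x => w x + m := by fun_prop
        obtain ⟨C, hC⟩ := (isCompact_Icc (a := a) (b := b)).exists_bound_of_continuousOn
          hc.continuousOn
        refine MemLp.of_bound hc.aestronglyMeasurable C ?_
        rw [ae_restrict_iff' measurableSet_Ioc]
        exact Eventually.of_forall fun x hx => hC x (Set.Ioc_subset_Icc_self hx)
      convert! h1.sub h2 using 1
      ext x
      by_cases hx : x ∈ Set.Ioc a b
      · simp only [hp, Set.indicator_of_mem hx, Pi.sub_apply]; ring
      · simp only [hp, Set.indicator_of_notMem hx, Pi.sub_apply]; ring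
    have hpl : LocallyIntegrable p volume := hpL2.locallyIntegrable (by norm_num)
    have hφ := IsLocalPrimitive.integral hpl a 0
    set φ : ℝ → ℝ := fun x => 0 + ∫ t in a..x, p t with hφdef
    have hφa : ∀ x ≤ a, φ x = 0 := by
      intro x hx
      simp only [hφdef, zero_add]
      rw [intervalIntegral.integral_symm, intervalIntegral.integral_of_le hx,
        setIntegral_eq_zero_of_forall_eq_zero, neg_zero]
      intro y hy
      exact Set.indicator_of_notMem (fun h => absurd h.1 (not_lt.2 hy.2)) _
    have hφb : ∀ x, b ≤ x → φ x = 0 := by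
      intro x hx
      have e1 : ∫ t in b..x, p t = 0 := by
        rw [intervalIntegral.integral_of_le hx]
        refine setIntegral_eq_zero_of_forall_eq_zero fun y hy => ?_
        exact Set.indicator_of_notMem (fun h => absurd h.2 (not_le.2 hy.1)) _
      have e2 : ∫ t in a..b, p t = 0 := by
        rw [intervalIntegral.integral_of_le hab.le, hp, setIntegral_indicator measurableSet_Ioc,
          Set.inter_self, ← intervalIntegral.integral_of_le hab.le,
          intervalIntegral.integral_sub (hvi.sub (hwc.intervalIntegrable a b)) (by simp),
          intervalIntegral.integral_const, hm, smul_eq_mul]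
        have : b - a ≠ 0 := by linarith
        field_simp
        ring
      simp only [hφdef, zero_add]
      rw [← intervalIntegral.integral_add_adjacent_intervals 
        (LocallyIntegrable.intervalIntegrable_real hpl a b)
        (LocallyIntegrable.intervalIntegrable_real hpl b x), e1, e2, add_zero]
    have hφs : HasCompactSupport φ := by
      refine HasCompactSupport.of_support_subset_isCompact (isCompact_Icc (a := a) (b := b)) ?_
      intro x hx
      by_contra hcon
      rw [Set.mem_Icc, not_and_or, not_le, not_le] at hcon
      rcases hcon with hc | hc
      · exact hx (hφa x hc.le)
      · exact hx (hφb x hc.le)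
    have hφc : Continuous φ := hφ.continuous
    have hdom : HarmonicFormDomain φ p :=
      ⟨hφ, hφc.memLp_of_hasCompactSupport hφs, hpL2,
        (continuous_id.mul hφc).memLp_of_hasCompactSupport hφs.mul_left⟩
    have hφi : Integrable φ volume := hφc.integrable_of_hasCompactSupport hφs
    have hr : IntervalIntegrable (fun x => v x - w x - m) volume a b :=
      (hvi.sub (hwc.intervalIntegrable a b)).sub (by simp)
    have hpi : Integrable p volume :=
      (integrable_indicator_iff measurableSet_Ioc).2 hr.1
    have f1 := hweak φ p hdom
    have i1 := h.integrable_form hq hdom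
    have i2 := h.memLp.integrable_fun_mul hdom.memLp
    have i3 := h.memLp_deriv.integrable_fun_mul hpL2
    have i4 : Integrable (fun x => W x * φ x) volume := by
      refine (i1.sub i3 |>.sub (i2.const_mul μ)).congr (Eventually.of_forall fun x => ?_)
      simp [hWdef]; ring
    have f2 : (∫ x, v x * p x) + ∫ x, W x * φ x = 0 := by
      rw [← integral_add i3 i4]
      rw [schrodingerForm, ← integral_const_mul, ← sub_eq_zero,
        ← integral_sub i1 (i2.const_mul μ)] at f1
      rw [← f1]
      congr 1 with x
      simp only [hWdef]; ring
    have i5 : Integrable (fun x => w x * p x) volume := by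
      convert! (integrable_indicator_iff measurableSet_Ioc).2
        (hr.continuousOn_mul hwc.continuousOn).1 using 1
      ext x
      by_cases hx : x ∈ Set.Ioc a b
      · simp only [hp, Set.indicator_of_mem hx]
      · simp only [hp, Set.indicator_of_notMem hx, mul_zero]
    have f3 : (∫ x, W x * φ x) + ∫ x, w x * p x = 0 := by
      rw [← integral_add i4 i5]
      exact (hw.mul hφ).integral_eq_zero (i4.add i5)
        ((hwc.mul hφc).integrable_of_hasCompactSupport hφs.mul_left)
    have f4 : ∫ x, p x = 0 := hφ.integral_eq_zero hpi hφi
    -- The weak equation and integration by parts give ∫ v p = −∫ W φ = ∫ w p, and the constant `m`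
    -- integrates to zero against `p`.
    have f5 : ∫ x, p x ^ 2 = 0 := by
      have e : ∀ x, p x ^ 2 = v x * p x - w x * p x - m * p x := by
        intro x
        by_cases hx : x ∈ Set.Ioc a b
        · simp only [hp, Set.indicator_of_mem hx]; ring
        · simp only [hp, Set.indicator_of_notMem hx]; ring
      simp_rw [e]
      have i35 : Integrable (fun x => v x * p x - w x * p x) volume := i3.sub i5
      rw [integral_sub i35 (hpi.const_mul m), integral_sub i3 i5,
        integral_const_mul, f4]
      linarith
    rw [integral_eq_zero_iff_of_nonneg (fun x => sq_nonneg _) hpL2.integrable_sq] at f5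
    filter_upwards [f5] with x hx hxm
    have hx' : p x = 0 := by simpa using hx
    simp only [hp, Set.indicator_of_mem hxm] at hx'
    linarith
  have local_eq' := fun n : ℕ => local_eq (-(n + 1 : ℝ)) (n + 1) (by
    have : (0 : ℝ) ≤ n := n.cast_nonneg
    linarith)
  choose m hm using local_eq'
  -- All the intervals contain (−1, 1], which has positive measure, so the constants agree.
  have hm0 : ∀ n, m n = m 0 := by
    intro n
    have h1 : ∀ᵐ x, x ∈ Set.Ioc (-1 : ℝ) 1 → m n = m 0 := by
      filter_upwards [hm n, hm 0] with x h1 h2 hx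
      have hn : (0 : ℝ) ≤ n := n.cast_nonneg
      have := h1 ⟨by linarith [hx.1], by linarith [hx.2]⟩
      have := h2 ⟨by simpa using hx.1, by simpa using hx.2⟩
      linarith
    by_contra hne
    have h2 : ∀ᵐ x, x ∉ Set.Ioc (-1 : ℝ) 1 := h1.mono fun x hx hmem => hne (hx hmem)
    have h3 : volume (Set.Ioc (-1 : ℝ) 1) = 0 := by
      rw [← compl_mem_ae_iff]; exact h2
    rw [Real.volume_Ioc] at h3
    norm_num at h3
  have hv : v =ᵐ[volume] fun x => m 0 + ∫ t in (0 : ℝ)..x, W t := by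
    filter_upwards [ae_all_iff.2 hm] with x hx
    obtain ⟨n, hn⟩ := exists_nat_ge |x|
    have := hx n ⟨by linarith [neg_abs_le x], by linarith [le_abs_self x]⟩
    rw [this, hm0 n, hwdef]
    ring
  have hu' := h.prim.congr hv
  have hv' := IsLocalPrimitive.integral hWl 0 (m 0)
  have hderiv : ∀ x, HasDerivAt u (m 0 + ∫ t in (0 : ℝ)..x, W t) x :=
    hu'.hasDerivAt hv'.continuous
  have hd : deriv u = fun x => m 0 + ∫ t in (0 : ℝ)..x, W t := funext fun x => (hderiv x).deriv
  refine ⟨fun x => (hderiv x).differentiableAt, fun a b => ?_, ?_, h.memLp⟩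
  · rw [hd]; exact hv'.absolutelyContinuousOnInterval a b
  · rw [hd]
    filter_upwards [hv'.ae_hasDerivAt] with x hx
    refine ⟨hx.differentiableAt, ?_⟩
    rw [hx.deriv]
    simp only [hWdef]; ring

/-! ### The form domain as a Hilbert space compactly embedded in L²(ℝ) -/

theorem HarmonicFormDomain.memLp_sqrt_mul {q u v : ℝ → ℝ} (hq : Integrable q volume)
    (hq0 : ∀ᵐ x, 0 ≤ q x) (h : HarmonicFormDomain u v) :
    MemLp (fun x => √(q x) * u x) 2 volume := by
  refine (memLp_two_iff_integrable_sq ?_).2 ((h.integrable_mul_mul h hq).congr ?_)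
  · exact (Real.continuous_sqrt.comp_aestronglyMeasurable hq.aestronglyMeasurable).mul
      h.continuous.aestronglyMeasurable
  · filter_upwards [hq0] with x hx
    rw [mul_pow, Real.sq_sqrt hx, pow_two]

/-- The real Hilbert space `L²(ℝ)⁴`, in which the form domain is embedded. -/
abbrev FormAmbient : Type := PiLp 2 fun _ : Fin 4 => Lp ℝ 2 (volume : Measure ℝ)

/-- `z` is the quadruple `(u, u', x u, √q u)`. -/
structure RepresentsForm (q : ℝ → ℝ) (z : FormAmbient) (u v : ℝ → ℝ) : Prop where
  dom : HarmonicFormDomain u v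
  val : z 0 =ᵐ[volume] u
  deriv : z 1 =ᵐ[volume] v
  id_mul : z 2 =ᵐ[volume] fun x => x * u x
  sqrt_mul : z 3 =ᵐ[volume] fun x => √(q x) * u x

/-- The form domain of `-d²/dx² + x² + q` as a subspace of `L²(ℝ)⁴`. -/
def formSpace (q : ℝ → ℝ) : Submodule ℝ FormAmbient where
  carrier := {z | ∃ u v, RepresentsForm q z u v}
  zero_mem' := by
    have h0 := Lp.coeFn_zero ℝ 2 (volume : Measure ℝ)
    refine ⟨_, _, HarmonicFormDomain.zero, h0, h0, ?_, ?_⟩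
    · simpa using! h0
    · simpa using! h0
  add_mem' := by
    rintro z w ⟨u, v, h⟩ ⟨u₁, v₁, h₁⟩
    refine ⟨_, _, h.dom.add h₁.dom, ?_, ?_, ?_, ?_⟩
    · filter_upwards [Lp.coeFn_add (z 0) (w 0), h.val, h₁.val] with x e e1 e2
      rw [PiLp.add_apply, e, Pi.add_apply, e1, e2]
    · filter_upwards [Lp.coeFn_add (z 1) (w 1), h.deriv, h₁.deriv] with x e e1 e2
      rw [PiLp.add_apply, e, Pi.add_apply, e1, e2]
    · filter_upwards [Lp.coeFn_add (z 2) (w 2), h.id_mul, h₁.id_mul] with x e e1 e2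
      rw [PiLp.add_apply, e, Pi.add_apply, e1, e2, mul_add]
    · filter_upwards [Lp.coeFn_add (z 3) (w 3), h.sqrt_mul, h₁.sqrt_mul] with x e e1 e2
      rw [PiLp.add_apply, e, Pi.add_apply, e1, e2, mul_add]
  smul_mem' := by
    rintro c z ⟨u, v, h⟩
    refine ⟨_, _, h.dom.const_mul c, ?_, ?_, ?_, ?_⟩
    · filter_upwards [Lp.coeFn_smul c (z 0), h.val] with x e e1
      rw [PiLp.smul_apply, e, Pi.smul_apply, e1, smul_eq_mul]
    · filter_upwards [Lp.coeFn_smul c (z 1), h.deriv] with x e e1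
      rw [PiLp.smul_apply, e, Pi.smul_apply, e1, smul_eq_mul]
    · filter_upwards [Lp.coeFn_smul c (z 2), h.id_mul] with x e e1
      rw [PiLp.smul_apply, e, Pi.smul_apply, e1, smul_eq_mul]; ring
    · filter_upwards [Lp.coeFn_smul c (z 3), h.sqrt_mul] with x e e1
      rw [PiLp.smul_apply, e, Pi.smul_apply, e1, smul_eq_mul]; ring

theorem HarmonicFormDomain.exists_representsForm {q u v : ℝ → ℝ} (hq : Integrable q volume)
    (hq0 : ∀ᵐ x, 0 ≤ q x) (h : HarmonicFormDomain u v) : ∃ z, RepresentsForm q z u v :=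
  ⟨WithLp.toLp 2 ![h.memLp.toLp _, h.memLp_deriv.toLp _, h.memLp_id_mul.toLp _,
    (h.memLp_sqrt_mul hq hq0).toLp _], h, h.memLp.coeFn_toLp, h.memLp_deriv.coeFn_toLp,
    h.memLp_id_mul.coeFn_toLp, (h.memLp_sqrt_mul hq hq0).coeFn_toLp⟩

/-- The fourth component √q u is there to make the ambient inner product equal to the form plus the
L² product. -/
theorem RepresentsForm.inner_eq {q u v u₁ v₁ : ℝ → ℝ} {z w : FormAmbient}
    (hq : Integrable q volume) (hq0 : ∀ᵐ x, 0 ≤ q x)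
    (h : RepresentsForm q z u v) (h₁ : RepresentsForm q w u₁ v₁) :
    inner ℝ z w = (∫ x, u x * u₁ x) + schrodingerForm q u v u₁ v₁ := by
  have key : ∀ {f g : Lp ℝ 2 (volume : Measure ℝ)} {a b : ℝ → ℝ}, f =ᵐ[volume] a →
      g =ᵐ[volume] b → inner ℝ f g = ∫ x, a x * b x := by
    intro f g a b ha hb
    rw [← Lp.toLp_coeFn f (Lp.memLp f), ← Lp.toLp_coeFn g (Lp.memLp g), inner_toLp_toLp]
    refine integral_congr_ae ?_
    filter_upwards [ha, hb] with x e1 e2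
    rw [e1, e2]
  rw [PiLp.inner_apply, Fin.sum_univ_four, key h.val h₁.val, key h.deriv h₁.deriv,
    key h.id_mul h₁.id_mul, key h.sqrt_mul h₁.sqrt_mul, schrodingerForm]
  have i1 := h.dom.memLp_deriv.integrable_fun_mul h₁.dom.memLp_deriv
  have i2 := h.dom.memLp_id_mul.integrable_fun_mul h₁.dom.memLp_id_mul
  have i12 : Integrable (fun x => v x * v₁ x + (x * u x) * (x * u₁ x)) volume := i1.add i2
  have i3 := h.dom.integrable_mul_mul h₁.dom hq
  rw [integral_add i12 i3, integral_add i1 i2]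
  have e : ∫ x, √(q x) * u x * (√(q x) * u₁ x) = ∫ x, q x * (u x * u₁ x) := by
    refine integral_congr_ae ?_
    filter_upwards [hq0] with x hx
    have := Real.mul_self_sqrt hx
    linear_combination (u x * u₁ x) * this
  rw [e]
  ring

theorem Lp.ae_eq_of_tendsto_of_ae_tendsto {F : ℕ → Lp ℝ 2 (volume : Measure ℝ)}
    {f : Lp ℝ 2 (volume : Measure ℝ)} {G : ℕ → ℝ → ℝ} {g : ℝ → ℝ} (hF : Tendsto F atTop (𝓝 f))
    (hG : ∀ n, F n =ᵐ[volume] G n) (hg : ∀ᵐ x, Tendsto (fun n => G n x) atTop (𝓝 (g x))) :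
    f =ᵐ[volume] g := by
  obtain ⟨ns, hns, hlim⟩ := (tendstoInMeasure_of_tendsto_Lp hF).exists_seq_tendsto_ae
  filter_upwards [hlim, ae_all_iff.2 hG, hg] with x h1 h2 h3
  refine tendsto_nhds_unique h1 ((h3.comp hns.tendsto_atTop).congr fun n => ?_)
  exact (h2 (ns n)).symm

theorem Lp.tendsto_intervalIntegral {F : ℕ → Lp ℝ 2 (volume : Measure ℝ)}
    {f : Lp ℝ 2 (volume : Measure ℝ)} (hF : Tendsto F atTop (𝓝 f)) (a b : ℝ) :
    Tendsto (fun n => ∫ x in a..b, F n x) atTop (𝓝 (∫ x in a..b, f x)) := by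
  have key : ∀ a b : ℝ, Tendsto (fun n => ∫ x in Set.Ioc a b, F n x) atTop
      (𝓝 (∫ x in Set.Ioc a b, f x)) := by
    intro a b
    have hs : MeasurableSet (Set.Ioc a b) := measurableSet_Ioc
    have hμ : volume (Set.Ioc a b) ≠ ⊤ := by simp
    have := (tendsto_const_nhds (x := indicatorConstLp 2 hs hμ (1 : ℝ))).inner (𝕜 := ℝ) hF
    simpa only [L2.inner_indicatorConstLp_one] using this
  exact (key a b).sub (key b a)

/-- A subsequence of the functions converges at one point x₀, and L² convergence of the derivatives
passes to integrals over bounded intervals. Hence the functions converge pointwise everywhere to a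
primitive of the limit derivative, which identifies the other three components. -/
theorem isClosed_formSpace (q : ℝ → ℝ) : IsClosed (formSpace q : Set FormAmbient) := by
  refine IsSeqClosed.isClosed ?_
  intro z z₀ hz hlim
  choose u v h using hz
  have hcomp : ∀ i, Tendsto (fun n => z n i) atTop (𝓝 (z₀ i)) := fun i =>
    ((PiLp.continuous_apply 2 _ i).tendsto z₀).comp hlim
  obtain ⟨ns, hns, hae⟩ := (tendstoInMeasure_of_tendsto_Lp (hcomp 0)).exists_seq_tendsto_ae
  obtain ⟨x₀, hx₀⟩ : ∃ x₀, Tendsto (fun k => u (ns k) x₀) atTop (𝓝 (z₀ 0 x₀)) := by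
    have : ∀ᵐ x, Tendsto (fun k => u (ns k) x) atTop (𝓝 (z₀ 0 x)) := by
      filter_upwards [hae, ae_all_iff.2 fun n => (h n).val] with x h1 h2
      exact h1.congr fun k => h2 (ns k)
    exact this.exists
  have hl : LocallyIntegrable (z₀ 1) volume := (Lp.memLp (z₀ 1)).locallyIntegrable (by norm_num)
  have hp := IsLocalPrimitive.integral hl x₀ (z₀ 0 x₀)
  have hpt : ∀ x, Tendsto (fun k => u (ns k) x) atTop
      (𝓝 (z₀ 0 x₀ + ∫ t in x₀..x, z₀ 1 t)) := by
    intro x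
    have h1 := ((Lp.tendsto_intervalIntegral (hcomp 1) x₀ x).comp hns.tendsto_atTop)
    refine (hx₀.add h1).congr fun k => ?_
    rw [(h (ns k)).dom.prim.eq_add x₀ x]
    congr 1
    exact intervalIntegral.integral_congr_ae ((h (ns k)).deriv.mono fun t ht _ => ht)
  have hsub : ∀ i, Tendsto (fun k => z (ns k) i) atTop (𝓝 (z₀ i)) := fun i =>
    (hcomp i).comp hns.tendsto_atTop
  have e0 := Lp.ae_eq_of_tendsto_of_ae_tendsto (hsub 0) (fun k => (h (ns k)).val)
    (Eventually.of_forall hpt)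
  have e2 := Lp.ae_eq_of_tendsto_of_ae_tendsto (hsub 2) (fun k => (h (ns k)).id_mul)
    (Eventually.of_forall fun x => (hpt x).const_mul x)
  have e3 := Lp.ae_eq_of_tendsto_of_ae_tendsto (hsub 3) (fun k => (h (ns k)).sqrt_mul)
    (Eventually.of_forall fun x => (hpt x).const_mul (√(q x)))
  exact ⟨_, _, ⟨hp, (memLp_congr_ae e0).1 (Lp.memLp _), Lp.memLp _,
    (memLp_congr_ae e2).1 (Lp.memLp _)⟩, e0, EventuallyEq.rfl, e2, e3⟩

instance (q : ℝ → ℝ) : CompleteSpace (formSpace q) :=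
  (isClosed_formSpace q).completeSpace_coe

/-- The embedding of the form domain into `L²(ℝ)`. -/
noncomputable def formEmbedding (q : ℝ → ℝ) :
    formSpace q →L[ℝ] Lp ℝ 2 (volume : Measure ℝ) :=
  (PiLp.proj 2 (fun _ : Fin 4 => Lp ℝ 2 (volume : Measure ℝ)) 0 : FormAmbient →L[ℝ] _) ∘L
    (formSpace q).subtypeL

/-- The orthogonal projection onto the span of the first `N` Hermite functions. -/
noncomputable def hermiteProj (N : ℕ) :
    Lp ℝ 2 (volume : Measure ℝ) →L[ℝ] Lp ℝ 2 (volume : Measure ℝ) :=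
  ∑ k ∈ Finset.range N, (innerSL ℝ (hermiteLp k)).smulRight (hermiteLp k)

theorem norm_sub_hermiteProj_sq (N : ℕ) (f : Lp ℝ 2 (volume : Measure ℝ)) :
    ‖f - hermiteProj N f‖ ^ 2 =
      ‖f‖ ^ 2 - ∑ k ∈ Finset.range N, (inner ℝ (hermiteLp k) f) ^ 2 := by
  have hP : hermiteProj N f = ∑ k ∈ Finset.range N, inner ℝ (hermiteLp k) f • hermiteLp k := by
    simp [hermiteProj]
  have h2 : inner ℝ (hermiteProj N f) (hermiteProj N f) =
      ∑ k ∈ Finset.range N, (inner ℝ (hermiteLp k) f) ^ 2 := by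
    rw [hP, orthonormal_hermiteLp.inner_sum]
    simp [pow_two]
  have h1 : inner ℝ f (hermiteProj N f) =
      ∑ k ∈ Finset.range N, (inner ℝ (hermiteLp k) f) ^ 2 := by
    rw [hP, inner_sum]
    refine Finset.sum_congr rfl fun k _ => ?_
    rw [real_inner_smul_right, real_inner_comm, pow_two]
  rw [norm_sub_sq_real, h1, ← real_inner_self_eq_norm_sq (hermiteProj N f), h2]
  ring

/-- By `energy_ge` the Hermite tail beyond N costs energy at least 2N per unit of squared norm; the
potential `q` only adds energy. -/
theorem norm_formEmbedding_sub_sq_le {q : ℝ → ℝ} (hq : Integrable q volume)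
    (hq0 : ∀ᵐ x, 0 ≤ q x) (N : ℕ) (z : formSpace q) :
    2 * N * ‖formEmbedding q z - hermiteProj N (formEmbedding q z)‖ ^ 2 ≤ ‖z‖ ^ 2 := by
  obtain ⟨⟨z, hz⟩, rfl⟩ : ∃ y, y = z := ⟨z, rfl⟩
  obtain ⟨u, v, h⟩ := hz
  have hJ : formEmbedding q ⟨z, ⟨u, v, h⟩⟩ = h.dom.memLp.toLp u := by
    refine Lp.ext ?_
    exact h.val.trans h.dom.memLp.coeFn_toLp.symm
  rw [norm_sub_hermiteProj_sq, hJ, ← real_inner_self_eq_norm_sq, inner_toLp_toLp]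
  simp_rw [hermiteLp, inner_toLp_toLp]
  have h1 := h.dom.energy_ge N
  have h2 : ‖(⟨z, ⟨u, v, h⟩⟩ : formSpace q)‖ ^ 2 = inner ℝ z z := by
    rw [real_inner_self_eq_norm_sq]; rfl
  rw [h2, h.inner_eq hq hq0 h, schrodingerForm]
  have i1 := h.dom.memLp_deriv.integrable_fun_mul h.dom.memLp_deriv
  have i2 := h.dom.memLp_id_mul.integrable_fun_mul h.dom.memLp_id_mul
  have i12 : Integrable (fun x => v x * v x + (x * u x) * (x * u x)) volume := i1.add i2
  rw [integral_add i12 (h.dom.integrable_mul_mul h.dom hq), integral_add i1 i2]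
  have h3 : 0 ≤ ∫ x, q x * (u x * u x) := integral_nonneg_of_ae (by
    filter_upwards [hq0] with x hx
    exact mul_nonneg hx (mul_self_nonneg _))
  have h4 : 0 ≤ ∫ x, u x ^ 2 := integral_nonneg fun x => sq_nonneg _
  simp_rw [mul_comm (hermiteFun _ _)]
  simp_rw [pow_two] at h1 h4 ⊢
  linarith

/-- The embedding is an operator norm limit of finite-rank truncations, with error at most
(2N)^(−1/2). -/
theorem isCompactOperator_formEmbedding {q : ℝ → ℝ} (hq : Integrable q volume)
    (hq0 : ∀ᵐ x, 0 ≤ q x) : IsCompactOperator (formEmbedding q) := by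
  have hP : ∀ N, IsCompactOperator (hermiteProj N ∘L formEmbedding q) := by
    intro N
    have : IsCompactOperator (hermiteProj N) := by
      induction N with
      | zero => simpa [hermiteProj] using isCompactOperator_zero
      | succ N ih =>
        have e : hermiteProj (N + 1) = hermiteProj N +
            ((ContinuousLinearMap.id ℝ ℝ).smulRight (hermiteLp N)) ∘L
              (innerSL ℝ (hermiteLp N)) := by
          rw [hermiteProj, Finset.sum_range_succ, ← hermiteProj]
          rfl
        rw [e]
        refine ih.add ?_
        exact (isCompactOperator_of_locallyCompactSpace_rng
          (ContinuousLinearMap.smulRight (ContinuousLinearMap.id ℝ ℝ) (hermiteLp N))).comp_clm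
          (innerSL ℝ (hermiteLp N))
    exact this.comp_clm (formEmbedding q)
  refine isCompactOperator_of_tendsto (l := atTop)
    (F := fun N : ℕ => hermiteProj N ∘L formEmbedding q) ?_ (Eventually.of_forall hP)
  refine (tendsto_iff_norm_sub_tendsto_zero
    (E := formSpace q →L[ℝ] Lp ℝ 2 (volume : Measure ℝ))).2 ?_
  have hlim : Tendsto (fun N : ℕ => √((2 * (N : ℝ))⁻¹)) atTop (𝓝 0) := by
    have h1 : Tendsto (fun N : ℕ => (2 * (N : ℝ))⁻¹) atTop (𝓝 0) :=
      tendsto_inv_atTop_zero.comp (tendsto_natCast_atTop_atTop.const_mul_atTop two_pos)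
    have h2 := (Real.continuous_sqrt.tendsto 0).comp h1
    rwa [Real.sqrt_zero] at h2
  refine squeeze_zero' (Eventually.of_forall fun N =>
    norm_nonneg (hermiteProj N ∘L formEmbedding q - formEmbedding q)) ?_ hlim
  filter_upwards [eventually_gt_atTop 0] with N hN
  refine ContinuousLinearMap.opNorm_le_bound _ (Real.sqrt_nonneg _) fun z => ?_
  have h := norm_formEmbedding_sub_sq_le hq hq0 N z
  have hN' : (0 : ℝ) < 2 * N := by positivity
  rw [sub_apply, norm_sub_rev]
  refine le_of_sq_le_sq ?_ (by positivity)
  rw [mul_pow, Real.sq_sqrt (by positivity), inv_mul_eq_div, le_div_iff₀ hN', mul_comm]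
  exact h

/-! ### Completeness of the eigenfunctions -/

/-- Completeness of the eigenfunctions of `-d²/dx² + x² + q`. -/
theorem ae_eq_zero_of_forall_integral_mul_eigenfunction_eq_zero {q f : ℝ → ℝ}
    (hq : Integrable q volume) (hq0 : ∀ᵐ x, 0 ≤ q x) (hf : MemLp f 2 volume)
    (h : ∀ μ u, IsSchrodingerL2Solution (fun x => x ^ 2 + q x) μ u → ∫ x, f x * u x = 0) :
    f =ᵐ[volume] 0 := by
  set J := formEmbedding q with hJ
  -- Since the inner product of the form space is the form plus the L² product, `T` is the inverse
  -- of −d²/dx² + x² + q + 1: compact, symmetric and injective.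
  set T := J ∘L ContinuousLinearMap.adjoint J with hT
  have hTc : IsCompactOperator T := (isCompactOperator_formEmbedding hq hq0).comp_clm _
  have hTs : T.IsSymmetric := by
    intro x y
    simp only [ContinuousLinearMap.coe_coe, hT, ContinuousLinearMap.comp_apply]
    rw [← ContinuousLinearMap.adjoint_inner_right, ContinuousLinearMap.adjoint_inner_left]
  have hpair : ∀ (g : Lp ℝ 2 (volume : Measure ℝ)) (φ ψ : ℝ → ℝ) (w : FormAmbient)
      (hw : RepresentsForm q w φ ψ),
      inner ℝ ((ContinuousLinearMap.adjoint J g : formSpace q) : FormAmbient) w =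
        ∫ x, g x * φ x := by
    intro g φ ψ w hw
    have h1 := ContinuousLinearMap.adjoint_inner_left J (⟨w, φ, ψ, hw⟩ : formSpace q) g
    have h2 : J (⟨w, φ, ψ, hw⟩ : formSpace q) = hw.dom.memLp.toLp φ :=
      Lp.ext (hw.val.trans hw.dom.memLp.coeFn_toLp.symm)
    rw [h2] at h1
    refine h1.trans ?_
    conv_lhs => rw [← Lp.toLp_coeFn g (Lp.memLp g)]
    exact inner_toLp_toLp _ _
  -- If J* g = 0, then g is orthogonal to the whole form domain, in particular to all Hermite
  -- functions.
  have hinj : ∀ g, T g = 0 → g = 0 := by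
    intro g hg
    have h0 : ContinuousLinearMap.adjoint J g = 0 := by
      rw [← inner_self_eq_zero (𝕜 := ℝ), ContinuousLinearMap.adjoint_inner_right]
      have : J (ContinuousLinearMap.adjoint J g) = 0 := hg
      rw [this, inner_zero_left]
    refine eq_zero_of_forall_inner_hermiteLp_eq_zero g fun k => ?_
    obtain ⟨w, hw⟩ := (harmonicFormDomain_hermiteFun k).exists_representsForm hq hq0
    have h1 := hpair g _ _ w hw
    rw [h0] at h1
    rw [real_inner_comm, ← Lp.toLp_coeFn g (Lp.memLp g), hermiteLp, inner_toLp_toLp, ← h1]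
    simp
  have hbot := ContinuousLinearMap.orthogonalComplement_iSup_eigenspaces_eq_bot hTc hTs
  have hmem : hf.toLp f ∈
      (⨆ μ, Module.End.eigenspace (T : Module.End ℝ (Lp ℝ 2 (volume : Measure ℝ))) μ)ᗮ := by
    rw [← Submodule.iInf_orthogonal, Submodule.mem_iInf]
    intro μ
    rw [Submodule.mem_orthogonal]
    intro g hg
    have hg' : T g = μ • g := Module.End.mem_eigenspace_iff.1 hg
    by_cases hμ : μ = 0
    · rw [hinj g (by rw [hg', hμ, zero_smul]), inner_zero_left]
    · obtain ⟨u, v, hz⟩ := (ContinuousLinearMap.adjoint J g : formSpace q).2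
      have hgu : u =ᵐ[volume] fun x => μ * g x := by
        have e1 : T g =ᵐ[volume] u := hz.val
        rw [hg'] at e1
        filter_upwards [e1, Lp.coeFn_smul μ g] with x e2 e3
        rw [← e2, e3, Pi.smul_apply, smul_eq_mul]
      -- An eigenvalue μ ≠ 0 of the shifted inverse corresponds to the eigenvalue μ⁻¹ − 1 of the
      -- differential operator.
      have hsol : IsSchrodingerL2Solution (fun x => x ^ 2 + q x) (μ⁻¹ - 1) u := by
        refine hz.dom.isSchrodingerL2Solution hq fun φ ψ hφ => ?_
        obtain ⟨w, hw⟩ := hφ.exists_representsForm hq hq0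
        have h1 := hpair g φ ψ w hw
        rw [hz.inner_eq hq hq0 hw] at h1
        have h2 : ∫ x, u x * φ x = μ * ∫ x, g x * φ x := by
          rw [← integral_const_mul]
          refine integral_congr_ae ?_
          filter_upwards [hgu] with x hx
          rw [hx]; ring
        rw [sub_mul, one_mul, h2, ← mul_assoc, inv_mul_cancel₀ hμ, one_mul]
        rw [h2] at h1
        linarith
      have h3 := h _ _ hsol
      rw [real_inner_comm, ← Lp.toLp_coeFn g (Lp.memLp g), inner_toLp_toLp]
      have h4 : ∫ x, f x * u x = μ * ∫ x, f x * g x := by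
        rw [← integral_const_mul]
        refine integral_congr_ae ?_
        filter_upwards [hgu] with x hx
        rw [hx]; ring
      rw [h4] at h3
      exact (mul_eq_zero.1 h3).resolve_left hμ
  rw [hbot, Submodule.mem_bot] at hmem
  have := hf.coeFn_toLp
  rw [hmem] at this
  exact this.symm.trans (Lp.coeFn_zero ℝ 2 volume)

/-! ### Algebra of the form and the strict lower bound for eigenvalues -/

section FormAlgebra

variable {q u v u₁ v₁ : ℝ → ℝ}

theorem schrodingerForm_comm (q u v u₁ v₁ : ℝ → ℝ) :
    schrodingerForm q u v u₁ v₁ = schrodingerForm q u₁ v₁ u v := by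
  rw [schrodingerForm, schrodingerForm]
  congr 1 with x
  ring

theorem schrodingerForm_self (hq : Integrable q volume) (h : HarmonicFormDomain u v) :
    schrodingerForm q u v u v =
      (∫ x, v x ^ 2) + (∫ x, (x * u x) ^ 2) + ∫ x, q x * u x ^ 2 := by
  have i1 := h.memLp_deriv.integrable_fun_mul h.memLp_deriv
  have i2 := h.memLp_id_mul.integrable_fun_mul h.memLp_id_mul
  have i12 : Integrable (fun x => v x * v x + (x * u x) * (x * u x)) volume := i1.add i2
  rw [schrodingerForm, integral_add i12 (h.integrable_mul_mul h hq), integral_add i1 i2]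
  simp_rw [pow_two]

theorem schrodingerForm_sum {ι : Type*} (s : Finset ι) (c : ι → ℝ) {U W : ι → ℝ → ℝ}
    (hq : Integrable q volume) (h : ∀ i, HarmonicFormDomain (U i) (W i))
    (h₁ : HarmonicFormDomain u v) :
    schrodingerForm q (fun x => ∑ i ∈ s, c i * U i x) (fun x => ∑ i ∈ s, c i * W i x) u v =
      ∑ i ∈ s, c i * schrodingerForm q (U i) (W i) u v := by
  simp only [schrodingerForm]
  simp_rw [← integral_const_mul]
  rw [← integral_finsetSum s fun i _ => ((h i).integrable_form hq h₁).const_mul (c i)]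
  congr 1 with x
  simp only [Finset.mul_sum, Finset.sum_mul, ← Finset.sum_add_distrib]
  refine Finset.sum_congr rfl fun i _ => ?_
  ring

theorem integral_sum_mul {ι : Type*} (s : Finset ι) (c : ι → ℝ) {U : ι → ℝ → ℝ} {f : ℝ → ℝ}
    (h : ∀ i, MemLp (U i) 2 volume) (hf : MemLp f 2 volume) :
    ∫ x, (∑ i ∈ s, c i * U i x) * f x = ∑ i ∈ s, c i * ∫ x, U i x * f x := by
  simp_rw [← integral_const_mul]
  rw [← integral_finsetSum s fun i _ => ((h i).integrable_fun_mul hf).const_mul (c i)]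
  congr 1 with x
  rw [Finset.sum_mul]
  exact Finset.sum_congr rfl fun i _ => by ring

theorem schrodingerForm_sub_self (hq : Integrable q volume) (h : HarmonicFormDomain u v)
    (h₁ : HarmonicFormDomain u₁ v₁) :
    schrodingerForm q (fun x => u x - u₁ x) (fun x => v x - v₁ x) (fun x => u x - u₁ x)
      (fun x => v x - v₁ x) = schrodingerForm q u v u v - 2 * schrodingerForm q u₁ v₁ u v +
        schrodingerForm q u₁ v₁ u₁ v₁ := by
  have i1 := h.integrable_form hq h
  have i2 := (h₁.integrable_form hq h).const_mul 2
  have i3 := h₁.integrable_form hq h₁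
  simp only [schrodingerForm]
  rw [← integral_const_mul, ← integral_sub i1 i2, ← integral_add (by exact i1.sub i2) i3]
  congr 1 with x
  ring

end FormAlgebra

theorem schrodingerForm_self_nonneg {q u v : ℝ → ℝ} (hq0 : ∀ᵐ x, 0 ≤ q x) :
    0 ≤ schrodingerForm q u v u v := by
  refine integral_nonneg_of_ae ?_
  filter_upwards [hq0] with x hx
  have := mul_nonneg hx (mul_self_nonneg (u x))
  simp only [Pi.zero_apply]
  nlinarith [mul_self_nonneg (v x), mul_self_nonneg (x * u x)]

theorem exists_ne_zero_sum_mul_eq_zero {ι κ : Type*} [Fintype ι] [Fintype κ]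
    (hcard : Fintype.card κ < Fintype.card ι) (a : ι → κ → ℝ) :
    ∃ α : ι → ℝ, α ≠ 0 ∧ ∀ j, ∑ i, α i * a i j = 0 := by
  classical
  have hker : LinearMap.ker (Fintype.linearCombination ℝ a) ≠ ⊥ :=
    LinearMap.ker_ne_bot_of_finrank_lt (by simpa using hcard)
  obtain ⟨α, hα, hα0⟩ := (Submodule.ne_bot_iff _).1 hker
  refine ⟨α, hα0, fun j => ?_⟩
  have := congrFun (LinearMap.mem_ker.1 hα) j
  simpa [Fintype.linearCombination_apply, Finset.sum_apply] using this

namespace IsSchrodingerL2Solution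

variable {q u u₁ : ℝ → ℝ} {μ ν : ℝ}

theorem integral_mul_eq_zero (hq : Integrable q volume) (hq0 : ∀ᵐ x, 0 ≤ q x)
    (h : IsSchrodingerL2Solution (fun x => x ^ 2 + q x) μ u)
    (h₁ : IsSchrodingerL2Solution (fun x => x ^ 2 + q x) ν u₁) (hne : μ ≠ ν) :
    ∫ x, u x * u₁ x = 0 := by
  have e1 := h.schrodingerForm_eq hq hq0 (h₁.harmonicFormDomain hq0)
  have e2 := h₁.schrodingerForm_eq hq hq0 (h.harmonicFormDomain hq0)
  rw [schrodingerForm_comm, e2] at e1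
  simp_rw [mul_comm (u₁ _)] at e1
  have : (μ - ν) * ∫ x, u x * u₁ x = 0 := by linarith
  exact (mul_eq_zero.1 this).resolve_left (sub_ne_zero.2 hne)

theorem integral_sq_pos (h : IsSchrodingerL2Solution (fun x => x ^ 2 + q x) μ u) (hu : u ≠ 0) :
    0 < ∫ x, u x * u x := by
  have hc := h.prim.continuous
  obtain ⟨x, hx⟩ := Function.ne_iff.1 hu
  exact integral_pos_of_integrable_nonneg_nonzero (hc.mul hc)
    (h.memLp.integrable_fun_mul h.memLp) (fun x => mul_self_nonneg _) (x := x)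
    (mul_self_ne_zero.2 hx)

/-- By uniqueness for the initial value problem, u' ≠ 0 at every zero of u, so zeros are isolated.
-/
theorem countable_zeros (hq : Integrable q volume)
    (h : IsSchrodingerL2Solution (fun x => x ^ 2 + q x) μ u) (hu : u ≠ 0) :
    {x | u x = 0}.Countable := by
  have hd : DiscreteTopology {x | u x = 0} := by
    rw [discreteTopology_subtype_iff]
    intro x hx
    have hx' : deriv u x ≠ 0 := fun h1 => hu (h.eq_zero_of_initial hq hx h1)
    have h2 := (h.differentiable x).hasDerivAt.eventually_ne (c := 0) hx'
    rw [← disjoint_iff, Filter.disjoint_principal_right]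
    exact h2
  exact Set.countable_coe_iff.1 countable_of_Lindelof_of_discrete

/-- A zero integral would give q u² = 0 almost everywhere; u has a null set of zeros, so q would
vanish almost everywhere. -/
theorem integral_potential_mul_sq_pos (hq : Integrable q volume) (hq0 : ∀ᵐ x, 0 ≤ q x)
    (hq1 : ∫ x, q x ≠ 0) (h : IsSchrodingerL2Solution (fun x => x ^ 2 + q x) μ u) (hu : u ≠ 0) :
    0 < ∫ x, q x * (u x * u x) := by
  have hd := h.harmonicFormDomain hq0
  have hn : 0 ≤ᵐ[volume] fun x => q x * (u x * u x) :=
    hq0.mono fun x hx => mul_nonneg hx (mul_self_nonneg _)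
  refine lt_of_le_of_ne (integral_nonneg_of_ae hn) fun h0 => hq1 ?_
  have h1 := (integral_eq_zero_iff_of_nonneg_ae hn (hd.integrable_mul_mul hd hq)).1 h0.symm
  have h2 : ∀ᵐ x, u x ≠ 0 := by
    have := (h.countable_zeros hq hu).measure_zero volume
    rwa [← compl_mem_ae_iff] at this
  refine integral_eq_zero_of_ae ?_
  filter_upwards [h1, h2] with x e1 e2
  simpa [e2] using e1

/-- If `μ 0 < ⋯ < μ n` are eigenvalues of `-d²/dx² + x² + q`, then `μ n > 2 n + 1`. -/
theorem two_mul_add_one_lt_of_strictMono (hq : Integrable q volume) (hq0 : ∀ᵐ x, 0 ≤ q x)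
    (hq1 : ∫ x, q x ≠ 0) {n : ℕ} {μ : Fin (n + 1) → ℝ} (hμ : StrictMono μ)
    {u : Fin (n + 1) → ℝ → ℝ}
    (h : ∀ i, IsSchrodingerL2Solution (fun x => x ^ 2 + q x) (μ i) (u i)) (hu : ∀ i, u i ≠ 0) :
    2 * (n : ℝ) + 1 < μ (Fin.last n) := by
  by_contra! hcon
  -- There are n+1 coefficients for n orthogonality conditions, so some nonzero choice makes `w`
  -- orthogonal to the first n Hermite functions.
  obtain ⟨α, hα, hαz⟩ := exists_ne_zero_sum_mul_eq_zero (κ := Fin n) (by simp)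
    (fun (i : Fin (n + 1)) (j : Fin n) => ∫ x, u i x * hermiteFun j x)
  have hd := fun i => (h i).harmonicFormDomain hq0
  set w : ℝ → ℝ := fun x => ∑ i, α i * u i x with hw
  set w' : ℝ → ℝ := fun x => ∑ i, α i * deriv (u i) x with hw'
  have hwd : HarmonicFormDomain w w' := HarmonicFormDomain.sum _ fun i _ => (hd i).const_mul (α i)
  have horth : ∀ i, ∫ x, u i x * w x = α i * ∫ x, u i x * u i x := by
    intro i
    have := integral_sum_mul Finset.univ α (fun i => (hd i).memLp) (hd i).memLp
    simp_rw [mul_comm (u i _) (w _)]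
    rw [this, Finset.sum_eq_single i]
    · intro j _ hj
      rw [(h j).integral_mul_eq_zero hq hq0 (h i) (hμ.injective.ne hj), mul_zero]
    · simp
  have e1 : schrodingerForm q w w' w w' = ∑ i, α i ^ 2 * (∫ x, u i x * u i x) * μ i := by
    rw [hw, hw', schrodingerForm_sum Finset.univ α hq hd hwd]
    refine Finset.sum_congr rfl fun i _ => ?_
    rw [(h i).schrodingerForm_eq hq hq0 hwd, horth]
    ring
  have e2 : ∫ x, w x ^ 2 = ∑ i, α i ^ 2 * ∫ x, u i x * u i x := by
    simp_rw [pow_two (w _)]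
    conv_lhs => rw [hw]
    rw [integral_sum_mul Finset.univ α (fun i => (hd i).memLp) hwd.memLp]
    refine Finset.sum_congr rfl fun i _ => ?_
    rw [horth]
    ring
  have e3 := hwd.energy_ge n
  have e4 : ∑ k ∈ Finset.range n, (∫ x, w x * hermiteFun k x) ^ 2 = 0 := by
    refine Finset.sum_eq_zero fun k hk => ?_
    have := hαz ⟨k, Finset.mem_range.1 hk⟩
    rw [hw, integral_sum_mul Finset.univ α (fun i => (hd i).memLp) (memLp_hermiteFun k), this]
    simp
  have e5 : 0 ≤ ∫ x, q x * w x ^ 2 := integral_nonneg_of_ae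
    (hq0.mono fun x hx => mul_nonneg hx (sq_nonneg _))
  have e6 := schrodingerForm_self hq hwd
  rw [e4, sub_zero] at e3
  have e7 : ∑ i, α i ^ 2 * (∫ x, u i x * u i x) * (2 * n + 1 - μ i) =
      (2 * n + 1) * (∫ x, w x ^ 2) - schrodingerForm q w w' w w' := by
    rw [e1, e2, Finset.mul_sum, ← Finset.sum_sub_distrib]
    exact Finset.sum_congr rfl fun i _ => by ring
  have hterm : ∀ i, 0 ≤ α i ^ 2 * (∫ x, u i x * u i x) * (2 * n + 1 - μ i) := fun i =>
    mul_nonneg (mul_nonneg (sq_nonneg _) ((h i).integral_sq_pos (hu i)).le)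
      (by linarith [hμ.monotone (Fin.le_last i)])
  -- If μ n ≤ 2n+1, the spectral bound for `w` leaves no room: every term of this sum vanishes, and
  -- so does ∫ q w².
  have hsum : ∑ i, α i ^ 2 * (∫ x, u i x * u i x) * (2 * n + 1 - μ i) = 0 :=
    le_antisymm (by rw [e7]; linarith) (Finset.sum_nonneg fun i _ => hterm i)
  have hq2 : ∫ x, q x * w x ^ 2 = 0 := by
    refine le_antisymm ?_ e5
    rw [hsum] at e7
    linarith
  -- Strict monotonicity leaves only the top eigenfunction in `w`, and ∫ q w² = 0 then contradicts
  -- `integral_potential_mul_sq_pos`.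
  have hαi : ∀ i, i ≠ Fin.last n → α i = 0 := by
    intro i hi
    have h1 := (Finset.sum_eq_zero_iff_of_nonneg fun i _ => hterm i).1 hsum i (Finset.mem_univ i)
    have h2 : 0 < 2 * (n : ℝ) + 1 - μ i := by
      have := hμ (lt_of_le_of_ne (Fin.le_last i) hi)
      linarith
    have h3 := ((h i).integral_sq_pos (hu i)).ne'
    simpa [h2.ne', h3] using h1
  have hαl : α (Fin.last n) ≠ 0 := fun h0 => hα (funext fun i => by
    by_cases hi : i = Fin.last n
    · rw [hi, h0]; rfl
    · exact hαi i hi)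
  have hwl : ∀ x, w x = α (Fin.last n) * u (Fin.last n) x := fun x => by
    simp only [hw]
    exact Finset.sum_eq_single _ (fun i _ hi => by rw [hαi i hi, zero_mul]) (by simp)
  have hpos := (h (Fin.last n)).integral_potential_mul_sq_pos hq hq0 hq1 (hu _)
  have e8 : ∫ x, q x * w x ^ 2 = α (Fin.last n) ^ 2 *
      ∫ x, q x * (u (Fin.last n) x * u (Fin.last n) x) := by
    rw [← integral_const_mul]
    congr 1 with x
    rw [hwl]; ring
  rw [hq2] at e8
  have : 0 < α (Fin.last n) ^ 2 := by positivity
  nlinarith [mul_pos this hpos]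

end IsSchrodingerL2Solution

/-! ### Eigenbases and the trace estimate -/

/-- An orthonormal eigenbasis of `-d²/dx² + x² + q` with increasing eigenvalues. -/
structure IsSchrodingerEigenbasis (q : ℝ → ℝ) (lam : ℕ → ℝ) (e : ℕ → ℝ → ℝ) : Prop where
  strictMono : StrictMono lam
  solution : ∀ k, IsSchrodingerL2Solution (fun x => x ^ 2 + q x) (lam k) (e k)
  norm_eq_one : ∀ k, ∫ x, e k x * e k x = 1
  complete : ∀ μ u, IsSchrodingerL2Solution (fun x => x ^ 2 + q x) μ u → u ≠ 0 →
    ∃ k, lam k = μ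

namespace IsSchrodingerEigenbasis

variable {q : ℝ → ℝ} {lam : ℕ → ℝ} {e : ℕ → ℝ → ℝ}

theorem ne_zero (h : IsSchrodingerEigenbasis q lam e) (k : ℕ) : e k ≠ 0 := by
  intro h0
  have := h.norm_eq_one k
  simp [h0] at this

theorem integral_mul (hq : Integrable q volume) (hq0 : ∀ᵐ x, 0 ≤ q x)
    (h : IsSchrodingerEigenbasis q lam e) (i j : ℕ) :
    ∫ x, e i x * e j x = if i = j then 1 else 0 := by
  split_ifs with hij
  · rw [hij, h.norm_eq_one]
  · exact (h.solution i).integral_mul_eq_zero hq hq0 (h.solution j)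
      (h.strictMono.injective.ne hij)

theorem lower_bound (hq : Integrable q volume) (hq0 : ∀ᵐ x, 0 ≤ q x) (hq1 : ∫ x, q x ≠ 0)
    (h : IsSchrodingerEigenbasis q lam e) (k : ℕ) : 2 * (k : ℝ) + 1 < lam k :=
  IsSchrodingerL2Solution.two_mul_add_one_lt_of_strictMono hq hq0 hq1
    (μ := fun i : Fin (k + 1) => lam i) (fun _ _ hij => h.strictMono hij)
    (u := fun i => e i) (fun i => h.solution i) (fun i => h.ne_zero i)

/-- Parseval's identity. By simplicity, orthogonality to each `e k` is orthogonality to every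
eigenfunction, so the completeness theorem applies. -/
theorem hasSum_sq (hq : Integrable q volume) (hq0 : ∀ᵐ x, 0 ≤ q x)
    (h : IsSchrodingerEigenbasis q lam e) {f : ℝ → ℝ} (hf : MemLp f 2 volume) :
    HasSum (fun j => (∫ x, f x * e j x) ^ 2) (∫ x, f x ^ 2) := by
  have hon : Orthonormal ℝ fun k => (h.solution k).memLp.toLp (e k) := by
    rw [orthonormal_iff_ite]
    intro i j
    rw [inner_toLp_toLp, h.integral_mul hq hq0]
  let b := HilbertBasis.mkOfOrthogonalEqBot hon (by
    rw [Submodule.eq_bot_iff]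
    intro g hg
    refine (Lp.eq_zero_iff_ae_eq_zero).2 ?_
    refine ae_eq_zero_of_forall_integral_mul_eigenfunction_eq_zero hq hq0 (Lp.memLp g)
      fun μ u hu => ?_
    by_cases hu0 : u = 0
    · simp [hu0]
    · obtain ⟨k, rfl⟩ := h.complete μ u hu hu0
      obtain ⟨c, rfl⟩ := (h.solution k).exists_smul_eq hq hq0 hu (h.ne_zero k)
      have h1 := (Submodule.mem_orthogonal _ _).1 hg _ (Submodule.subset_span ⟨k, rfl⟩)
      rw [real_inner_comm, ← Lp.toLp_coeFn g (Lp.memLp g), inner_toLp_toLp] at h1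
      have e1 : ∀ x, g x * (c • e k) x = c * (g x * e k x) := fun x => by
        rw [Pi.smul_apply, smul_eq_mul]; ring
      simp_rw [e1]
      rw [integral_const_mul, h1, mul_zero])
  have hs := b.hasSum_inner_mul_inner (hf.toLp f) (hf.toLp f)
  simp only [b, HilbertBasis.coe_mkOfOrthogonalEqBot] at hs
  rw [inner_toLp_toLp hf hf] at hs
  simp_rw [← pow_two] at hs
  convert! hs using 2 with k
  rw [real_inner_comm (hf.toLp f), ← pow_two, inner_toLp_toLp]

/-- Bessel's inequality for the quadratic form. -/
theorem sum_mul_sq_le_form (hq : Integrable q volume) (hq0 : ∀ᵐ x, 0 ≤ q x)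
    (h : IsSchrodingerEigenbasis q lam e) {φ ψ : ℝ → ℝ} (hφ : HarmonicFormDomain φ ψ)
    (s : Finset ℕ) :
    ∑ j ∈ s, lam j * (∫ x, φ x * e j x) ^ 2 ≤ schrodingerForm q φ ψ φ ψ := by
  have hd := fun i => (h.solution i).harmonicFormDomain hq0
  set c : ℕ → ℝ := fun j => ∫ x, φ x * e j x with hc
  set g : ℝ → ℝ := fun x => ∑ j ∈ s, c j * e j x with hg
  set g' : ℝ → ℝ := fun x => ∑ j ∈ s, c j * deriv (e j) x with hg'
  have hgd : HarmonicFormDomain g g' := HarmonicFormDomain.sum _ fun i _ => (hd i).const_mul (c i)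
  have e1 : schrodingerForm q g g' φ ψ = ∑ j ∈ s, lam j * c j ^ 2 := by
    rw [hg, hg', schrodingerForm_sum s c hq hd hφ]
    refine Finset.sum_congr rfl fun i _ => ?_
    rw [(h.solution i).schrodingerForm_eq hq hq0 hφ]
    simp_rw [mul_comm (e i _)]
    simp only [hc]; ring
  have e2 : schrodingerForm q g g' g g' = ∑ j ∈ s, lam j * c j ^ 2 := by
    have : ∀ i ∈ s, ∫ x, e i x * g x = c i := by
      intro i hi
      simp_rw [mul_comm (e i _)]
      rw [hg, integral_sum_mul s c (fun i => (hd i).memLp) (hd i).memLp]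
      simp_rw [h.integral_mul hq hq0]
      simp [hi]
    conv_lhs => rw [hg, hg']
    rw [schrodingerForm_sum s c hq hd hgd]
    refine Finset.sum_congr rfl fun i hi => ?_
    rw [(h.solution i).schrodingerForm_eq hq hq0 hgd, this i hi]
    ring
  have e3 := schrodingerForm_sub_self hq hφ hgd
  -- The form is nonnegative on φ minus its projection `g`, and the cross term equals the form of
  -- `g`.
  have e4 := schrodingerForm_self_nonneg (u := fun x => φ x - g x) (v := fun x => ψ x - g' x) hq0
  rw [e3, e1, e2] at e4
  linarith

/-- The trace estimate for the sum of the first `n + 1` eigenvalues. -/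
theorem sum_le (hq : Integrable q volume) (hq0 : ∀ᵐ x, 0 ≤ q x)
    (h : IsSchrodingerEigenbasis q lam e) (n : ℕ) :
    ∑ k ∈ Finset.range (n + 1), (lam k - (2 * (k : ℝ) + 1)) ≤
      omegaConst n / Real.pi * ∫ x, q x := by
  -- `P j` is the squared length of the projection of `e j` onto the span of the trial functions:
  -- weights in [0, 1] with total n + 1.
  set P : ℕ → ℝ := fun j => ∑ k ∈ Finset.range (n + 1), (∫ x, hermiteFun k x * e j x) ^ 2 with hP
  set B : ℝ := ∑ k ∈ Finset.range (n + 1), schrodingerForm q (hermiteFun k) (hermiteFunDeriv k)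
    (hermiteFun k) (hermiteFunDeriv k) with hB
  have hP0 : ∀ j, 0 ≤ P j := fun j => Finset.sum_nonneg fun k _ => sq_nonneg _
  have hP1 : ∀ j, P j ≤ 1 := by
    intro j
    have := sum_sq_integral_mul_hermiteFun_le (h.solution j).memLp (Finset.range (n + 1))
    simp_rw [pow_two (e j _), h.norm_eq_one] at this
    simp_rw [mul_comm (e j _)] at this
    exact this
  have hPs : HasSum P (n + 1) := by
    have := hasSum_sum (s := Finset.range (n + 1)) fun k _ =>
      h.hasSum_sq hq hq0 (memLp_hermiteFun k)
    convert! this using 1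
    simp_rw [pow_two (hermiteFun _ _), integral_hermiteFun_mul_hermiteFun]
    simp
  have hPB : ∀ s : Finset ℕ, ∑ j ∈ s, lam j * P j ≤ B := by
    intro s
    simp only [hP, hB, Finset.mul_sum]
    rw [Finset.sum_comm]
    exact Finset.sum_le_sum fun k _ =>
      h.sum_mul_sq_le_form hq hq0 (harmonicFormDomain_hermiteFun k) s
  -- A bathtub argument: Σ lam_j P_j is smallest when the weights fill the n+1 lowest levels.
  -- Comparing with lam_n below and above that level leaves a defect proportional to the missing
  -- weight, which tends to 0.
  have hKF : ∀ M ≥ n + 1, ∑ j ∈ Finset.range (n + 1), lam j +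
      lam n * (∑ j ∈ Finset.range M, P j - (n + 1)) ≤ B := by
    intro M hM
    refine le_trans ?_ (hPB (Finset.range M))
    rw [← Finset.sum_range_add_sum_Ico _ hM, ← Finset.sum_range_add_sum_Ico _ hM]
    have h1 : ∑ j ∈ Finset.range (n + 1), (lam j * (1 - P j)) ≤
        ∑ j ∈ Finset.range (n + 1), (lam n * (1 - P j)) := Finset.sum_le_sum fun j hj =>
      mul_le_mul_of_nonneg_right
        (h.strictMono.monotone (Nat.lt_succ_iff.1 (Finset.mem_range.1 hj)))
        (by linarith [hP1 j])
    have h2 : ∑ j ∈ Finset.Ico (n + 1) M, lam n * P j ≤ ∑ j ∈ Finset.Ico (n + 1) M, lam j * P j :=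
      Finset.sum_le_sum fun j hj => mul_le_mul_of_nonneg_right
        (h.strictMono.monotone (by have := (Finset.mem_Ico.1 hj).1; omega)) (hP0 j)
    simp only [mul_sub, mul_one, Finset.sum_sub_distrib, ← Finset.mul_sum, Finset.sum_const,
      Finset.card_range, nsmul_eq_mul] at h1 h2 ⊢
    push_cast at h1
    linarith
  have hlim := ((hPs.tendsto_sum_nat.sub_const ((n : ℝ) + 1)).const_mul (lam n)).const_add
    (∑ j ∈ Finset.range (n + 1), lam j)
  rw [sub_self, mul_zero, add_zero] at hlim
  have hfin := le_of_tendsto hlim (eventually_atTop.2 ⟨n + 1, hKF⟩)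
  have hi : ∀ k, Integrable (fun x => q x * hermiteFun k x ^ 2) volume := fun k => by
    simp_rw [pow_two]
    exact (harmonicFormDomain_hermiteFun k).integrable_mul_mul (harmonicFormDomain_hermiteFun k) hq
  have hBe : B = ∑ k ∈ Finset.range (n + 1), (2 * (k : ℝ) + 1) +
      ∫ x, q x * ∑ k ∈ Finset.range (n + 1), hermiteFun k x ^ 2 := by
    simp_rw [Finset.mul_sum]
    rw [integral_finsetSum _ fun k _ => hi k, ← Finset.sum_add_distrib, hB]
    refine Finset.sum_congr rfl fun k _ => ?_
    rw [schrodingerForm_self hq (harmonicFormDomain_hermiteFun k), hermiteFun_energy]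
  have hqb : ∫ x, q x * ∑ k ∈ Finset.range (n + 1), hermiteFun k x ^ 2 ≤
      omegaConst n / Real.pi * ∫ x, q x := by
    rw [← integral_const_mul]
    refine integral_mono_ae ?_ (hq.const_mul _) ?_
    · simp_rw [Finset.mul_sum]
      exact integrable_finsetSum _ fun k _ => hi k
    · filter_upwards [hq0] with x hx
      rw [mul_comm]
      exact mul_le_mul_of_nonneg_right (sum_hermiteFun_sq_le n x) hx
  rw [Finset.sum_sub_distrib]
  linarith

end IsSchrodingerEigenbasis

/-! ### Enumerating the eigenvalues -/

/-- The set of eigenvalues of `-d²/dx² + x² + q` on `L²(ℝ)`. -/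
def schrodingerEigenvalues (q : ℝ → ℝ) : Set ℝ :=
  {μ | ∃ u, IsSchrodingerL2Solution (fun x => x ^ 2 + q x) μ u ∧ u ≠ 0}

section

variable {q : ℝ → ℝ}

theorem exists_normalized_of_mem_schrodingerEigenvalues {μ : ℝ}
    (h : μ ∈ schrodingerEigenvalues q) :
    ∃ u, IsSchrodingerL2Solution (fun x => x ^ 2 + q x) μ u ∧ ∫ x, u x * u x = 1 := by
  obtain ⟨u, hu, hu0⟩ := h
  have hpos := hu.integral_sq_pos hu0
  refine ⟨(√(∫ x, u x * u x))⁻¹ • u, (schrodingerEigenspace _ μ).smul_mem _ hu, ?_⟩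
  have e : ∀ x, ((√(∫ x, u x * u x))⁻¹ • u) x * ((√(∫ x, u x * u x))⁻¹ • u) x =
      (∫ x, u x * u x)⁻¹ * (u x * u x) := fun x => by
    have : (√(∫ x, u x * u x))⁻¹ * (√(∫ x, u x * u x))⁻¹ = (∫ x, u x * u x)⁻¹ := by
      rw [← mul_inv, Real.mul_self_sqrt hpos.le]
    simp only [Pi.smul_apply, smul_eq_mul]
    rw [← this]; ring
  simp_rw [e]
  rw [integral_const_mul, inv_mul_cancel₀ hpos.ne']

/-- Choose n ≥ M: among any n+1 eigenvalues the largest exceeds 2n+1 > M. -/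
theorem finite_schrodingerEigenvalues_inter_Iic (hq : Integrable q volume)
    (hq0 : ∀ᵐ x, 0 ≤ q x) (hq1 : ∫ x, q x ≠ 0) (M : ℝ) :
    (schrodingerEigenvalues q ∩ Set.Iic M).Finite := by
  by_contra hinf
  obtain ⟨n, hn⟩ := exists_nat_ge M
  obtain ⟨t, ht, hcard⟩ := Set.Infinite.exists_subset_card_eq hinf (n + 1)
  have hmem : ∀ i, t.orderEmbOfFin hcard i ∈ schrodingerEigenvalues q ∩ Set.Iic M := fun i =>
    ht (t.orderEmbOfFin_mem hcard i)
  choose u hu hu0 using fun i => (hmem i).1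
  have := IsSchrodingerL2Solution.two_mul_add_one_lt_of_strictMono hq hq0 hq1
    (t.orderEmbOfFin hcard).strictMono hu hu0
  have h2 : t.orderEmbOfFin hcard (Fin.last n) ≤ M := (hmem (Fin.last n)).2
  have h3 : (0 : ℝ) ≤ n := n.cast_nonneg
  linarith

/-- If there were only N eigenvalues, all simple, a nonzero combination of N+1 Hermite functions
would be orthogonal to every eigenfunction and vanish by completeness, against linear independence.
-/
theorem infinite_schrodingerEigenvalues (hq : Integrable q volume) (hq0 : ∀ᵐ x, 0 ≤ q x) :
    (schrodingerEigenvalues q).Infinite := by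
  intro hfin
  have := hfin.fintype
  choose e he he0 using fun μ : schrodingerEigenvalues q => μ.2
  obtain ⟨α, hα, hz⟩ := exists_ne_zero_sum_mul_eq_zero
    (ι := Fin (Fintype.card (schrodingerEigenvalues q) + 1)) (κ := schrodingerEigenvalues q)
    (by simp) (fun i μ => ∫ x, hermiteFun i x * e μ x)
  have hd := HarmonicFormDomain.sum Finset.univ
    fun (i : Fin (Fintype.card (schrodingerEigenvalues q) + 1)) _ =>
      (harmonicFormDomain_hermiteFun i).const_mul (α i)
  have h0 := ae_eq_zero_of_forall_integral_mul_eigenfunction_eq_zero hq hq0 hd.memLp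
    fun μ u hu => by
      by_cases hu0 : u = 0
      · simp [hu0]
      · have hμ : μ ∈ schrodingerEigenvalues q := ⟨u, hu, hu0⟩
        obtain ⟨c, hc⟩ := (he ⟨μ, hμ⟩).exists_smul_eq hq hq0 hu (he0 ⟨μ, hμ⟩)
        rw [integral_sum_mul Finset.univ α (fun i : Fin _ => memLp_hermiteFun i) hu.memLp,
          ← mul_zero c, ← hz ⟨μ, hμ⟩, Finset.mul_sum]
        refine Finset.sum_congr rfl fun i _ => ?_
        have hint : ∫ x, hermiteFun i x * u x = c * ∫ x, hermiteFun i x * e ⟨μ, hμ⟩ x := by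
          rw [← integral_const_mul]
          refine integral_congr_ae (Eventually.of_forall fun x => ?_)
          have hx : c * e ⟨μ, hμ⟩ x = u x := congrFun hc x
          simp only [← hx]
          ring
        rw [hint, mul_left_comm]
  refine hα (funext fun j => ?_)
  have h1 := integral_sum_mul Finset.univ α
    (fun i : Fin (Fintype.card (schrodingerEigenvalues q) + 1) => memLp_hermiteFun i)
    (memLp_hermiteFun j)
  have h2 : ∫ x, (∑ i, α i * hermiteFun i x) * hermiteFun j x = 0 :=
    integral_eq_zero_of_ae (h0.mono fun x hx => by
      simp only [Pi.zero_apply] at hx ⊢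
      rw [hx, zero_mul])
  rw [h2] at h1
  simpa [integral_hermiteFun_mul_hermiteFun, Fin.val_inj] using h1.symm

end

/-- An infinite set of reals that is finite below every bound is the range of a strictly
increasing sequence tending to infinity. -/
theorem exists_strictMono_range_eq {S : Set ℝ} (hinf : S.Infinite)
    (hfin : ∀ M, (S ∩ Set.Iic M).Finite) :
    ∃ lam : ℕ → ℝ, StrictMono lam ∧ Set.range lam = S ∧ Tendsto lam atTop atTop := by
  -- A linear order that is locally finite with a least and no greatest element is order isomorphic
  -- to ℕ.
  let _ : LocallyFiniteOrder S := LocallyFiniteOrder.ofFiniteIcc fun a b => by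
    refine Set.Finite.of_finite_image (f := Subtype.val) ((hfin b).subset ?_)
      Subtype.val_injective.injOn
    rintro _ ⟨x, hx, rfl⟩
    exact ⟨x.2, hx.2⟩
  let _ : SuccOrder S := LinearLocallyFiniteOrder.succOrder S
  let _ : PredOrder S := LinearLocallyFiniteOrder.predOrder S
  obtain ⟨y, hy⟩ := hinf.nonempty
  obtain ⟨m, hm, hmin⟩ := (hfin y).exists_minimal ⟨y, hy, Set.mem_Iic.2 le_rfl⟩
  let _ : OrderBot S :=
    { bot := ⟨m, hm.1⟩
      bot_le := fun x => by
        rcases le_total m x with h | h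
        · exact h
        · exact hmin ⟨x.2, h.trans hm.2⟩ h }
  have : NoMaxOrder S := ⟨fun a => by
    by_contra! hcon
    exact hinf ((hfin a).subset fun x hx => ⟨hx, hcon ⟨x, hx⟩⟩)⟩
  let f : S ≃o ℕ := orderIsoNatOfLinearSuccPredArch
  have hmono : StrictMono fun k => (f.symm k : ℝ) := fun i j hij => f.symm.strictMono hij
  refine ⟨fun k => (f.symm k : ℝ), hmono, ?_, ?_⟩
  · ext x
    constructor
    · rintro ⟨k, rfl⟩
      exact (f.symm k).2
    · intro hx
      exact ⟨f ⟨x, hx⟩, by simp⟩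
  · refine tendsto_atTop_atTop_of_monotone hmono.monotone fun M => ?_
    by_contra! hcon
    refine Set.infinite_range_of_injective hmono.injective ((hfin M).subset ?_)
    rintro _ ⟨k, rfl⟩
    exact ⟨(f.symm k).2, (hcon k).le⟩

section

variable {q : ℝ → ℝ} {lam : ℕ → ℝ}

theorem rank_schrodingerEigenspace_ne_zero_iff {μ : ℝ} :
    Module.rank ℝ (schrodingerEigenspace (fun x => x ^ 2 + q x) μ) ≠ 0 ↔
      μ ∈ schrodingerEigenvalues q := by
  rw [Ne, Submodule.rank_eq_zero, ← Ne, Submodule.ne_bot_iff]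
  rfl

theorem isSchrodingerEigenvalueSequence_of_strictMono (hq : Integrable q volume)
    (hq0 : ∀ᵐ x, 0 ≤ q x) (hmono : StrictMono lam)
    (hrange : Set.range lam = schrodingerEigenvalues q) (htop : Tendsto lam atTop atTop) :
    IsSchrodingerEigenvalueSequence (fun x => x ^ 2 + q x) lam := by
  refine ⟨hmono.monotone, htop, fun μ => ?_⟩
  have hle := IsSchrodingerL2Solution.rank_eigenspace_le_one hq hq0 μ
  by_cases hμ : μ ∈ schrodingerEigenvalues q
  · have h1 : Module.rank ℝ (schrodingerEigenspace (fun x => x ^ 2 + q x) μ) = 1 :=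
      le_antisymm hle (Cardinal.one_le_iff_ne_zero.2 (rank_schrodingerEigenspace_ne_zero_iff.2 hμ))
    rw [h1, Cardinal.eq_one_iff_unique]
    rw [← hrange] at hμ
    obtain ⟨k, hk⟩ := hμ
    exact ⟨⟨fun i j => Subtype.ext (hmono.injective (i.2.trans j.2.symm))⟩, ⟨⟨k, hk⟩⟩⟩
  · have h0 := not_not.1 (mt rank_schrodingerEigenspace_ne_zero_iff.1 hμ)
    rw [h0, Cardinal.mk_eq_zero_iff]
    exact ⟨fun j => hμ (hrange ▸ ⟨j.1, j.2⟩)⟩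

/-- Simplicity means no value is listed twice, so the monotone list is strictly increasing. -/
theorem IsSchrodingerEigenvalueSequence.exists_eigenbasis (hq : Integrable q volume)
    (hq0 : ∀ᵐ x, 0 ≤ q x) (h : IsSchrodingerEigenvalueSequence (fun x => x ^ 2 + q x) lam) :
    ∃ e, IsSchrodingerEigenbasis q lam e := by
  have hmem : ∀ k, lam k ∈ schrodingerEigenvalues q := fun k => by
    rw [← rank_schrodingerEigenspace_ne_zero_iff, ← h.multiplicity, Cardinal.mk_ne_zero_iff]
    exact ⟨⟨k, rfl⟩⟩
  have hinj : Function.Injective lam := by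
    intro i j hij
    have h1 : Cardinal.mk {k : ℕ // lam k = lam j} ≤ 1 := by
      rw [h.multiplicity]
      exact IsSchrodingerL2Solution.rank_eigenspace_le_one hq hq0 _
    have h2 := Cardinal.le_one_iff_subsingleton.1 h1
    exact congrArg Subtype.val (Subsingleton.elim (⟨i, hij⟩ : {k : ℕ // lam k = lam j}) ⟨j, rfl⟩)
  choose e he he1 using fun k => exists_normalized_of_mem_schrodingerEigenvalues (hmem k)
  refine ⟨e, h.monotone.strictMono_of_injective hinj, he, he1, fun μ u hu hu0 => ?_⟩
  have h1 := rank_schrodingerEigenspace_ne_zero_iff.2 (show μ ∈ schrodingerEigenvalues q from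
    ⟨u, hu, hu0⟩)
  rw [← h.multiplicity, Cardinal.mk_ne_zero_iff] at h1
  obtain ⟨⟨k, hk⟩⟩ := h1
  exact ⟨k, hk⟩

end

/-! ### Jensen's inequality and the conclusion -/

/-- Jensen's inequality for `x ↦ x ^ (-s)`. -/
theorem rpow_neg_le_average_rpow_neg {n : ℕ} {a : ℕ → ℝ} {B s : ℝ} (ha : ∀ k, 0 < a k)
    (hs : 0 < s) (hB : ∑ k ∈ Finset.range (n + 1), a k ≤ (n + 1) * B) :
    B ^ (-s) ≤ 1 / ((n : ℝ) + 1) * ∑ k ∈ Finset.range (n + 1), a k ^ (-s) := by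
  have hn : (0 : ℝ) < n + 1 := by positivity
  have hBpos : 0 < B := by
    have : 0 < ∑ k ∈ Finset.range (n + 1), a k := Finset.sum_pos (fun k _ => ha k) (by simp)
    by_contra! hcon
    nlinarith
  -- This is the tangent line of r ↦ r^(−s) at r = 1, with r = a k / B; it follows from e^y ≥ 1 + y
  -- and log r ≤ r − 1.
  have hterm : ∀ k, B ^ (-s) * (1 + s - s * (a k / B)) ≤ a k ^ (-s) := by
    intro k
    have hr : 0 < a k / B := div_pos (ha k) hBpos
    have h1 : a k ^ (-s) = B ^ (-s) * (a k / B) ^ (-s) := by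
      rw [← Real.mul_rpow hBpos.le hr.le, mul_div_cancel₀ _ hBpos.ne']
    rw [h1]
    refine mul_le_mul_of_nonneg_left ?_ (Real.rpow_nonneg hBpos.le _)
    rw [Real.rpow_def_of_pos hr]
    have h2 := Real.add_one_le_exp (Real.log (a k / B) * -s)
    have h3 := Real.log_le_sub_one_of_pos hr
    nlinarith
  have hsum := Finset.sum_le_sum fun k (_ : k ∈ Finset.range (n + 1)) => hterm k
  rw [← Finset.mul_sum, Finset.sum_sub_distrib, ← Finset.mul_sum, ← Finset.sum_div] at hsum
  simp only [Finset.sum_const, Finset.card_range, nsmul_eq_mul] at hsum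
  push_cast at hsum
  have h4 : (∑ k ∈ Finset.range (n + 1), a k) / B ≤ n + 1 := by
    rwa [div_le_iff₀ hBpos]
  have h5 : B ^ (-s) * (n + 1) ≤ ∑ k ∈ Finset.range (n + 1), a k ^ (-s) := by
    refine le_trans (mul_le_mul_of_nonneg_left ?_ (Real.rpow_nonneg hBpos.le _)) hsum
    nlinarith
  rw [one_div, inv_mul_eq_div, le_div_iff₀ hn]
  exact h5

theorem theorem6p1 (q : ℝ → ℝ) (hq_int : Integrable q volume)
    (hq_nonneg : ∀ᵐ x : ℝ, 0 ≤ q x) (hq_ne : (∫ x : ℝ, q x) ≠ 0) :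
    (∃ lam : ℕ → ℝ, IsSchrodingerEigenvalueSequence (fun x => x ^ 2 + q x) lam) ∧
    ∀ lam : ℕ → ℝ, IsSchrodingerEigenvalueSequence (fun x => x ^ 2 + q x) lam →
      (∀ k : ℕ, 0 < lam k - harmonicEigenvalue k) ∧
      ∀ (n : ℕ) (s : ℝ), 0 < s →
        1 / ((n : ℝ) + 1) *
            ∑ k ∈ Finset.range (n + 1), (lam k - harmonicEigenvalue k) ^ (-s) ≥
          (omegaConst n / (((n : ℝ) + 1) * Real.pi) * ∫ x : ℝ, q x) ^ (-s) := by
  refine ⟨?_, fun lam hlam => ?_⟩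
  · obtain ⟨lam, hmono, hrange, htop⟩ := exists_strictMono_range_eq
      (infinite_schrodingerEigenvalues hq_int hq_nonneg)
      (finite_schrodingerEigenvalues_inter_Iic hq_int hq_nonneg hq_ne)
    exact ⟨lam, isSchrodingerEigenvalueSequence_of_strictMono hq_int hq_nonneg hmono hrange htop⟩
  · obtain ⟨e, he⟩ := hlam.exists_eigenbasis hq_int hq_nonneg
    have hpos : ∀ k, 0 < lam k - harmonicEigenvalue k := fun k =>
      sub_pos.2 (he.lower_bound hq_int hq_nonneg hq_ne k)
    refine ⟨hpos, fun n s hs => rpow_neg_le_average_rpow_neg hpos hs ?_⟩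
    refine (he.sum_le hq_int hq_nonneg n).trans (le_of_eq ?_)
    have hp := Real.pi_pos.ne'
    field_simp
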